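/- **1-2-knapsack secretary problem.** An instance consists of $n$ items; item $i$ has a value $v_i\ge 0$ and a size $s_i\in\{1,2\}$, and the knapsack has capacity $2$. Items of size $1$ are called small. Let $v(\mathsf{OPT})$ be the maximum total value of a set of items of total size at most $2$. For $\alpha\ge 1$, the boosted profit of item $i$ is $v'_i=\alpha v_i$ if $i$ is small and $v'_i=v_i$ otherwise. As usual, ties are excluded: the values $v_i$ are pairwise distinct, and so are the boosted profits $v'_i$. For $c\in(0,1)$ and $\alpha\ge 1$, let $\mathsf{ALG}_{\alpha}$ be the following online algorithm, where the items arrive in uniformly random order. All items arriving in rounds $\ell\le cn$ are rejected (sampling phase). In each round $\ell> cn$, the arriving item is packed if and only if its boosted profit exceeds the boosted profits of all items of the sampling phase and its size is at most the remaining capacity. The algorithm is called $(1/e-o(1))$-competitive if there is a sequence $\delta_n\to 0$ such that, for every $n$ and every instance with $n$ items, the expected total (unboosted) value of the items packed is at least $(1/e-\delta_n)\cdot v(\mathsf{OPT})$. **Theorem.** Let $$\theta_{1,5}=-\frac{51}{16}+\frac{9}{4e}+\frac{75-522e+486e^2}{16-96e+288e^2-64e^3}\approx 1.400382,$$ where the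 approximation is correct to six decimals, i.e. $|\theta_{1,5}-1.400382|<5\cdot 10^{-7}$. For all $\alpha\ge 1$ and $c\in(0,1)$, the algorithm $\mathsf{ALG}_\alpha$ with sampling fraction $c$ is $(1/e-o(1))$-competitive for 1-2-knapsack if and only if $$\theta_{1,5}\le\alpha\le\frac{e}{e-1}\quad\text{and}\quad c=\frac1e .$$ -/

import Mathlib

open Filter Topology

/-- A knapsack instance with `n` items: each item has a nonnegative value and a size. -/
structure KnapsackInstance (n : ℕ) where
  value : Fin n → ℝ
  size : Fin n → ℕ
  value_nonneg : ∀ i, 0 ≤ value i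

namespace KnapsackInstance

variable {n : ℕ}

/-- All items have size `1` (small items) or `B` (large items). -/
def IsOneB (I : KnapsackInstance n) (B : ℕ) : Prop :=
  ∀ i, I.size i = 1 ∨ I.size i = B

/-- The total value of a set of items. -/
def totalValue (I : KnapsackInstance n) (S : Finset (Fin n)) : ℝ :=
  ∑ i ∈ S, I.value i

/-- The total size of a set of items. -/
def totalSize (I : KnapsackInstance n) (S : Finset (Fin n)) : ℕ :=
  ∑ i ∈ S, I.size i

/-- The packings for capacity `B`: sets of items of total size at most `B`. -/
def packings (I : KnapsackInstance n) (B : ℕ) : Finset (Finset (Fin n)) :=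
  Finset.univ.filter fun S => I.totalSize S ≤ B

theorem packings_nonempty (I : KnapsackInstance n) (B : ℕ) : (I.packings B).Nonempty :=
  ⟨∅, Finset.mem_filter.2 ⟨Finset.mem_univ _, by simp [totalSize]⟩⟩

/-- The value of an optimal (offline) packing for capacity `B`. -/
noncomputable def opt (I : KnapsackInstance n) (B : ℕ) : ℝ :=
  (I.packings B).sup' (I.packings_nonempty B) I.totalValue

/-- The boosted profits: values of small items (size `1`) are multiplied by `α`. -/
noncomputable def boosted (I : KnapsackInstance n) (α : ℝ) (i : Fin n) : ℝ :=
  if I.size i = 1 then α * I.value i else I.value i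

/-- Position `t` (counted from `0`, so this is round `t + 1`) belongs to the sampling phase
when `t + 1 ≤ c * n`. -/
def InSample (n : ℕ) (c : ℝ) (t : Fin n) : Prop :=
  ((t : ℕ) : ℝ) + 1 ≤ c * (n : ℝ)

open Classical in
/-- The extended secretary algorithm with sampling fraction `c` for capacity `B`, run on the
profits `w`, when the item `σ t` arrives at position `t`. The value is the set of items packed
in the first `t` rounds: in the sampling phase every item is rejected; afterwards the
arriving item is packed if its profit exceeds all profits of the sampling phase and
the remaining capacity is large enough. -/
noncomputable def packedAfter (I : KnapsackInstance n) (B : ℕ) (c : ℝ) (w : Fin n → ℝ)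
    (σ : Equiv.Perm (Fin n)) : ℕ → Finset (Fin n)
  | 0 => ∅
  | t + 1 =>
    if h : t < n then
      if ¬ InSample n c ⟨t, h⟩ ∧ (∀ s : Fin n, InSample n c s → w (σ s) < w (σ ⟨t, h⟩)) ∧
          I.totalSize (packedAfter I B c w σ t) + I.size (σ ⟨t, h⟩) ≤ B then
        insert (σ ⟨t, h⟩) (packedAfter I B c w σ t)
      else packedAfter I B c w σ t
    else packedAfter I B c w σ t

/-- The packing returned by the extended secretary algorithm on boosted profits, for the
arrival order `σ`. -/
noncomputable def boostedAlg (I : KnapsackInstance n) (B : ℕ) (α c : ℝ)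
    (σ : Equiv.Perm (Fin n)) : Finset (Fin n) :=
  I.packedAfter B c (I.boosted α) σ n

/-- The expected (unboosted) value of the packing returned by the boosted algorithm, when the
arrival order is uniformly random. -/
noncomputable def expectedValue (I : KnapsackInstance n) (B : ℕ) (α c : ℝ) : ℝ :=
  (∑ σ : Equiv.Perm (Fin n), I.totalValue (I.boostedAlg B α c σ)) /
    (Fintype.card (Equiv.Perm (Fin n)) : ℝ)

end KnapsackInstance

/-- The extended secretary algorithm with sampling fraction `c` and boosting factor `α` is
`(ρ - o(1))`-competitive for the 1-2-knapsack problem as the number `n` of items tends to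
infinity. The error `δ n` depends on `n` only, not on the instance. Instances have pairwise
distinct values, and pairwise distinct profits as seen by the algorithm. -/
def IsAsymptoticallyCompetitive (α c ρ : ℝ) : Prop :=
  ∃ δ : ℕ → ℝ, Tendsto δ atTop (𝓝 0) ∧
    ∀ (n : ℕ) (I : KnapsackInstance n), I.IsOneB 2 →
      Function.Injective I.value → Function.Injective (I.boosted α) →
        (ρ - δ n) * I.opt 2 ≤ I.expectedValue 2 α c

/-- The lower threshold for the boosting factor. -/
noncomputable def boostThreshold : ℝ :=
  -(51 / 16) + 9 / (4 * Real.exp 1) +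
    (75 - 522 * Real.exp 1 + 486 * Real.exp 1 ^ 2) /
      (16 - 96 * Real.exp 1 + 288 * Real.exp 1 ^ 2 - 64 * Real.exp 1 ^ 3)

/-!
Ranks are counted from `0` in the order of decreasing boosted profit.

*Reduction to a formula.* Suppose that the best sampled item has rank `j`. Then the items of rank
less than `j` all arrive after the sample, in uniformly random order, and the algorithm packs
greedily among them: the first one, and if that one is small, the next small one. A symmetry
argument (exchanging two items in the arrival order) shows that each of these `j` items is packed
with probability `1 / j`, or `2 / j` if it is small and not the only small one of them
(`card_mul_card_mem_greedy`). So the expected value is a sum over `j` of the probability `hitProb`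
of this event times the conditional value `condValue` (`expectedValue_eq`). With sampling fraction
`c` the law `hitProb` converges in `ℓ¹` to the geometric law `c (1 - c) ^ j`, while `condValue` is
at most twice the optimum. Hence, uniformly over all instances, the expected value may be replaced
by `limitValue`, which is linear in the numbers `a i = ∑ j > i, c (1 - c) ^ j / j` (`firstProb`).

*Necessity.* A single dominating large item gives `1 / e ≤ a 0 = -c log c`, so `c = 1 / e`. A
small item whose boosted profit is just above that of a large one gives `a 0 ≤ a 0 / α + a 1`,
that is, `α ≤ e / (e - 1)`. Two small items of almost equal value, of ranks `0` and `4`, with three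
large items of slightly larger profit than the second one in between, give `a 0 ≤ 3 a 4 + α (a 1 + a 2 + a 3)`, that is,
`boostThreshold ≤ α`.

*Sufficiency.* If the optimum is a single item, the items of ranks `0` and `1` yield enough. If it
is a pair of small items of ranks `r < s`, all other items of rank less than `s` are large, so of
value at least `α` times that of a small one behind them. An exchange argument
(`moved_to_front_le`) reduces this to `r = 0`, and then to
`a 0 ≤ 3 a s + α (a 1 + ⋯ + a (s - 1))`. The right side increases in `s` from `s = 4` on
(`mul_le_firstProb`), where the inequality is the definition of the threshold; the cases `s < 4`
are numerical (`firstProb_zero_le`).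
-/

/-! ### Arrival orders with a given set of items beating the sample -/

open Finset in
theorem card_filter_eq_of_mul_left {G : Type*} [Group G] [Fintype G] (τ : G) (p q : G → Prop)
    [DecidablePred p] [DecidablePred q] (h : ∀ σ, p σ ↔ q (τ * σ)) :
    #(univ.filter p) = #(univ.filter q) :=
  Finset.card_equiv (Equiv.mulLeft τ) (by simp [h])

theorem swap_mem_iff {α : Type*} [DecidableEq α] {T : Finset α} {x y : α} (hxy : x ∈ T ↔ y ∈ T)
    (z : α) : Equiv.swap x y z ∈ T ↔ z ∈ T := by
  rcases eq_or_ne z x with rfl | hx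
  · simp [hxy]
  rcases eq_or_ne z y with rfl | hy
  · simp [hxy]
  · rw [Equiv.swap_apply_of_ne_of_ne hx hy]

namespace KnapsackInstance

variable {n : ℕ}

/-- The arrival orders in which no item of `T` arrives at a position of `M`. -/
def avoiding (M T : Finset (Fin n)) : Finset (Equiv.Perm (Fin n)) :=
  Finset.univ.filter fun σ => ∀ t ∈ M, σ t ∉ T

/-- The arrival orders in which `y`, but no item of `T`, arrives at a position of `M`. -/
def separating (M T : Finset (Fin n)) (y : Fin n) : Finset (Equiv.Perm (Fin n)) :=
  Finset.univ.filter fun σ => (∀ t ∈ M, σ t ∉ T) ∧ ∃ t ∈ M, σ t = y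

/-- The item `x` is the first item of `T` to arrive. -/
def IsFirst (T : Finset (Fin n)) (σ : Equiv.Perm (Fin n)) (x : Fin n) : Prop :=
  x ∈ T ∧ ∃ t, σ t = x ∧ ∀ s < t, σ s ∉ T

instance (T : Finset (Fin n)) (σ : Equiv.Perm (Fin n)) (x : Fin n) : Decidable (IsFirst T σ x) := by
  unfold IsFirst; infer_instance

theorem IsFirst.eq {T : Finset (Fin n)} {σ : Equiv.Perm (Fin n)} {x y : Fin n}
    (hx : IsFirst T σ x) (hy : IsFirst T σ y) : x = y := by
  obtain ⟨hxT, s, rfl, hs⟩ := hx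
  obtain ⟨hyT, t, rfl, ht⟩ := hy
  rcases lt_trichotomy s t with h | h | h
  · exact absurd hxT (ht _ h)
  · rw [h]
  · exact absurd hyT (hs _ h)

open Finset

theorem card_separating_swap (M : Finset (Fin n)) {T : Finset (Fin n)} {y z : Fin n}
    (hy : y ∉ T) (hz : z ∉ T) : #(separating M T y) = #(separating M T z) := by
  refine card_filter_eq_of_mul_left (Equiv.swap y z) _ _ fun σ => ?_
  have h1 : ∀ t, Equiv.swap y z (σ t) ∈ T ↔ σ t ∈ T := fun t => swap_mem_iff (by simp [hy, hz]) _
  have h2 : ∀ t, Equiv.swap y z (σ t) = z ↔ σ t = y := fun t => by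
    rw [← Equiv.eq_symm_apply]; simp
  simp [Equiv.Perm.mul_apply, h1, h2]

/-- Among the orders avoiding `T`, every item outside `T` is equally likely to arrive at a
position of `M`. -/
theorem card_separating (M : Finset (Fin n)) {T : Finset (Fin n)} {y : Fin n} (hy : y ∉ T) :
    (n - #T) * #(separating M T y) = #M * #(avoiding M T) := by
  -- Count the pairs of an order avoiding `T` and an item arriving in `M`; such an item is not in `T`.
  have h1 : ∑ z ∈ Tᶜ, #(separating M T z) = (n - #T) * #(separating M T y) := by
    rw [sum_congr rfl fun z hz => card_separating_swap M (mem_compl.1 hz) hy]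
    simp [card_compl]
  rw [← h1]
  have h2 : ∀ z, #(separating M T z) =
      ∑ σ ∈ avoiding M T, if ∃ t ∈ M, σ t = z then 1 else 0 := fun z => by
    rw [← card_filter, separating, avoiding, filter_filter]
  simp_rw [h2]
  rw [sum_comm]
  rw [sum_congr rfl (g := fun _ => #M), sum_const, smul_eq_mul, mul_comm]
  intro σ hσ
  rw [← card_filter, ← card_map σ.toEmbedding (s := M)]
  congr 1
  ext z
  simp only [avoiding, mem_filter, mem_univ, true_and] at hσ
  simp only [mem_filter, mem_compl, Finset.mem_map, Equiv.coe_toEmbedding]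
  constructor
  · exact fun h => h.2
  · rintro ⟨t, ht, rfl⟩
    exact ⟨hσ t ht, t, ht, rfl⟩

theorem card_avoiding_insert (M : Finset (Fin n)) {T : Finset (Fin n)} {y : Fin n} :
    #(avoiding M (insert y T)) + #(separating M T y) = #(avoiding M T) := by
  have h : separating M T y = (avoiding M T).filter fun σ => ∃ t ∈ M, σ t = y := by
    rw [separating, avoiding, filter_filter]
  have h' : avoiding M (insert y T) = (avoiding M T).filter fun σ => ¬ ∃ t ∈ M, σ t = y := by
    rw [avoiding, avoiding, filter_filter]
    ext σ
    simp only [mem_filter, mem_univ, true_and, mem_insert]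
    grind
  rw [h, h', add_comm, card_filter_add_card_filter_not]

end KnapsackInstance

/-- The probability that `j` given items all arrive outside a sample of `m` out of `n`
positions. -/
noncomputable def missProb (n m j : ℕ) : ℝ := ∏ i ∈ Finset.range j, (1 - (m : ℝ) / ((n : ℝ) - i))

/-- The probability that `j` given items arrive outside a sample of `m` out of `n` positions and
a further given item arrives inside it. -/
noncomputable def hitProb (n m j : ℕ) : ℝ := missProb n m j - missProb n m (j + 1)

namespace KnapsackInstance

variable {n : ℕ}

open Finset

/-- By induction on `T`: of the `n - #T` items outside `T`, each is equally likely to arrive at one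
of the `#M` positions. -/
theorem card_avoiding (M T : Finset (Fin n)) :
    (#(avoiding M T) : ℝ) = missProb n #M #T * (n.factorial : ℝ) := by
  induction T using Finset.induction_on with
  | empty => simp [avoiding, missProb, Fintype.card_perm]
  | insert y T hy ih =>
    have h1 := card_separating M hy
    have h2 := card_avoiding_insert M (T := T) (y := y)
    have hlt : #T < n := by
      have := card_lt_univ_of_notMem hy
      simpa using this
    have h3 : ((n : ℝ) - #T) * (#(separating M T y) : ℝ) = #M * (#(avoiding M T) : ℝ) := by
      rw [← Nat.cast_sub hlt.le]; exact_mod_cast h1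
    have h4 : (#(avoiding M (insert y T)) : ℝ) + (#(separating M T y) : ℝ) = #(avoiding M T) := by
      exact_mod_cast h2
    have hpos : (n : ℝ) - #T ≠ 0 := by
      have : (#T : ℝ) < n := by exact_mod_cast hlt
      linarith
    rw [card_insert_of_notMem hy, missProb, prod_range_succ, ← missProb]
    have h5 : (#(separating M T y) : ℝ) = #M / ((n : ℝ) - #T) * (#(avoiding M T) : ℝ) := by
      field_simp; linarith
    rw [h5] at h4
    rw [ih] at h4
    linear_combination h4

theorem card_separating_eq (M : Finset (Fin n)) {T : Finset (Fin n)} {y : Fin n} (hy : y ∉ T) :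
    (#(separating M T y) : ℝ) = hitProb n #M #T * (n.factorial : ℝ) := by
  have h2 := card_avoiding_insert M (T := T) (y := y)
  have h4 : (#(avoiding M (insert y T)) : ℝ) + (#(separating M T y) : ℝ) = #(avoiding M T) := by
    exact_mod_cast h2
  rw [card_avoiding, card_avoiding, card_insert_of_notMem hy] at h4
  rw [hitProb]
  linear_combination h4

theorem exists_isFirst {T : Finset (Fin n)} (hT : T.Nonempty) (σ : Equiv.Perm (Fin n)) :
    ∃ x, IsFirst T σ x := by
  have hne : (univ.filter fun t => σ t ∈ T).Nonempty := by
    obtain ⟨x, hx⟩ := hT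
    exact ⟨σ.symm x, by simp [hx]⟩
  obtain ⟨t, ht, hmin⟩ := exists_min_image _ id hne
  refine ⟨σ t, (mem_filter.1 ht).2, t, rfl, fun s hs hsT => ?_⟩
  exact absurd (hmin s (by simp [hsT])) (not_le.2 hs)

/-- Each item of `T` is equally likely to be the first one of `T` to arrive. -/
theorem card_mul_card_isFirst (M : Finset (Fin n)) {T : Finset (Fin n)} {x y : Fin n}
    (hx : x ∈ T) (hy : y ∉ T) :
    #T * #((separating M T y).filter fun σ => IsFirst T σ x) = #(separating M T y) := by
  have hswap : ∀ z ∈ T, #((separating M T y).filter fun σ => IsFirst T σ z) =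
      #((separating M T y).filter fun σ => IsFirst T σ x) := by
    intro z hz
    rw [separating, filter_filter, filter_filter]
    refine card_filter_eq_of_mul_left (Equiv.swap z x) _ _ fun σ => ?_
    have h1 : ∀ t, Equiv.swap z x (σ t) ∈ T ↔ σ t ∈ T :=
      fun t => swap_mem_iff (by simp [hx, hz]) _
    have h2 : ∀ t, Equiv.swap z x (σ t) = x ↔ σ t = z := fun t => by
      rw [← Equiv.eq_symm_apply]; simp
    have h3 : ∀ t, Equiv.swap z x (σ t) = y ↔ σ t = y := fun t => by
      rw [← Equiv.eq_symm_apply, Equiv.symm_swap, Equiv.swap_apply_of_ne_of_ne]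
      · rintro rfl; exact hy hz
      · rintro rfl; exact hy hx
    simp [Equiv.Perm.mul_apply, h1, h2, h3, IsFirst, hx, hz]
  have h1 : ∑ z ∈ T, #((separating M T y).filter fun σ => IsFirst T σ z) =
      #T * #((separating M T y).filter fun σ => IsFirst T σ x) := by
    rw [sum_congr rfl hswap]; simp
  rw [← h1]
  simp_rw [card_filter]
  rw [sum_comm, card_eq_sum_ones]
  refine sum_congr rfl fun σ _ => ?_
  obtain ⟨z, hz⟩ := exists_isFirst ⟨x, hx⟩ σ
  rw [sum_eq_single_of_mem z hz.1 fun u _ hu => if_neg fun h => hu (h.eq hz), if_pos hz]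

/-! ### The greedy packing among the items beating the sample -/

/-- The greedy packing of capacity `2` restricted to the items of `T`: in each round, the arriving
item is packed if it belongs to `T` and fits. -/
def greedy (I : KnapsackInstance n) (T : Finset (Fin n)) (σ : Equiv.Perm (Fin n)) :
    ℕ → Finset (Fin n)
  | 0 => ∅
  | t + 1 =>
    if h : t < n then
      if σ ⟨t, h⟩ ∈ T ∧ I.totalSize (greedy I T σ t) + I.size (σ ⟨t, h⟩) ≤ 2 then
        insert (σ ⟨t, h⟩) (greedy I T σ t)
      else greedy I T σ t
    else greedy I T σ t

/-- When the best sampled item is `y`, the algorithm packs greedily among the items better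
than `y`. -/
theorem packedAfter_eq_greedy (I : KnapsackInstance n) {c : ℝ} {w : Fin n → ℝ}
    {M T : Finset (Fin n)} {y : Fin n} {σ : Equiv.Perm (Fin n)} (hM : ∀ t, t ∈ M ↔ InSample n c t)
    (hT : ∀ z, z ∈ T ↔ w y < w z) (hσ : σ ∈ separating M T y) (t : ℕ) :
    I.packedAfter 2 c w σ t = I.greedy T σ t := by
  obtain ⟨hav, s, hs, hsy⟩ := (mem_filter.1 hσ).2
  induction t with
  | zero => rfl
  | succ t ih =>
    rw [packedAfter, greedy, ih]
    by_cases h : t < n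
    · rw [dif_pos h, dif_pos h]
      have key : (¬ InSample n c ⟨t, h⟩ ∧ ∀ s : Fin n, InSample n c s → w (σ s) < w (σ ⟨t, h⟩)) ↔
          σ ⟨t, h⟩ ∈ T := by
        refine ⟨fun ⟨_, h2⟩ => ?_, fun h1 => ⟨fun h2 => ?_, fun u hu => ?_⟩⟩
        · rw [hT, ← hsy]; exact h2 s ((hM s).1 hs)
        · exact hav _ ((hM _).2 h2) h1
        · have := hav u ((hM u).2 hu)
          rw [hT, not_lt] at this
          exact this.trans_lt ((hT _).1 h1)
      simp only [← and_assoc, key]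
    · rw [dif_neg h, dif_neg h]

theorem greedy_swap (I : KnapsackInstance n) {T : Finset (Fin n)} {x y : Fin n}
    (hxy : x ∈ T ↔ y ∈ T) (hs : I.size x = I.size y) (σ : Equiv.Perm (Fin n)) (t : ℕ) :
    I.greedy T (Equiv.swap x y * σ) t = (I.greedy T σ t).map (Equiv.swap x y).toEmbedding := by
  have hsz : ∀ z, I.size (Equiv.swap x y z) = I.size z := fun z => by
    rcases eq_or_ne z x with rfl | hx
    · simp [hs]
    rcases eq_or_ne z y with rfl | hy
    · simp [hs]
    · rw [Equiv.swap_apply_of_ne_of_ne hx hy]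
  induction t with
  | zero => rfl
  | succ t ih =>
    rw [greedy, greedy, ih]
    have htot : I.totalSize ((I.greedy T σ t).map (Equiv.swap x y).toEmbedding) =
        I.totalSize (I.greedy T σ t) := by
      simp [totalSize, hsz]
    by_cases h : t < n
    · simp only [dif_pos h, Equiv.Perm.mul_apply, swap_mem_iff hxy, hsz, htot]
      split_ifs
      · rw [map_insert]; rfl
      · rfl
    · rw [dif_neg h, dif_neg h]

/-- The possible states of the greedy packing after `t` rounds: no item of `T` has arrived; the
first one is large; the first one is small and no other small one has arrived; two small items
are packed. -/
theorem greedy_cases (I : KnapsackInstance n) (hI : I.IsOneB 2) (T : Finset (Fin n))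
    (σ : Equiv.Perm (Fin n)) (t : ℕ) :
    ((∀ s : Fin n, (s : ℕ) < t → σ s ∉ T) ∧ I.greedy T σ t = ∅) ∨
    ∃ f, IsFirst T σ f ∧
      ((I.size f = 2 ∧ I.greedy T σ t = {f}) ∨
       (I.size f = 1 ∧ I.greedy T σ t = {f} ∧
          ∀ s : Fin n, (s : ℕ) < t → σ s ∈ T → I.size (σ s) = 1 → σ s = f) ∨
       (I.size f = 1 ∧ ∃ g, g ≠ f ∧ g ∈ T ∧ I.size g = 1 ∧ I.greedy T σ t = {f, g})) := by
  induction t with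
  | zero => left; simp [greedy]
  | succ t ih =>
    rw [greedy]
    by_cases h : t < n
    swap
    · rw [dif_neg h]
      have h1 : ∀ s : Fin n, (s : ℕ) < t + 1 → (s : ℕ) < t := fun s _ => by omega
      rcases ih with ⟨h2, h3⟩ | ⟨f, hf, h2 | ⟨h2, h3, h4⟩ | h2⟩
      · exact .inl ⟨fun s hs => h2 s (h1 s hs), h3⟩
      · exact .inr ⟨f, hf, .inl h2⟩
      · exact .inr ⟨f, hf, .inr (.inl ⟨h2, h3, fun s hs => h4 s (h1 s hs)⟩)⟩
      · exact .inr ⟨f, hf, .inr (.inr h2)⟩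
    rw [dif_pos h]
    have hcases : ∀ s : Fin n, (s : ℕ) < t + 1 → (s : ℕ) < t ∨ s = ⟨t, h⟩ := fun s hs => by
      rcases Nat.lt_succ_iff_lt_or_eq.1 hs with h | h
      · exact .inl h
      · exact .inr (Fin.ext h)
    have hsz := hI (σ ⟨t, h⟩)
    rcases ih with ⟨h2, h3⟩ | ⟨f, hf, ⟨h2, h3⟩ | ⟨h2, h3, h4⟩ | ⟨h2, g, hgf, hgT, hg, h3⟩⟩
    · rw [h3]
      by_cases hT : σ ⟨t, h⟩ ∈ T
      · have hfirst : IsFirst T σ (σ ⟨t, h⟩) := ⟨hT, _, rfl, fun s hs => h2 s hs⟩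
        right
        refine ⟨_, hfirst, ?_⟩
        rcases hsz with hsz | hsz
        · right; left
          refine ⟨hsz, by simp [hT, hsz, totalSize], fun s hs hsT _ => ?_⟩
          rcases hcases s hs with h5 | h5
          · exact absurd hsT (h2 s h5)
          · rw [h5]
        · left
          exact ⟨hsz, by simp [hT, hsz, totalSize]⟩
      · left
        refine ⟨fun s hs => ?_, by simp [hT]⟩
        rcases hcases s hs with h5 | h5
        · exact h2 s h5
        · rwa [h5]
    · right
      refine ⟨f, hf, .inl ⟨h2, ?_⟩⟩
      rw [h3, if_neg]
      rintro ⟨_, h5⟩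
      simp only [totalSize, sum_singleton, h2] at h5
      omega
    · right
      refine ⟨f, hf, .inr ?_⟩
      rw [h3]
      by_cases hT : σ ⟨t, h⟩ ∈ T ∧ I.size (σ ⟨t, h⟩) = 1
      · by_cases he : σ ⟨t, h⟩ = f
        · left
          refine ⟨h2, by rw [he]; simp, fun s hs hsT hs1 => ?_⟩
          rcases hcases s hs with h5 | h5
          · exact h4 s h5 hsT hs1
          · rw [h5, he]
        · right
          refine ⟨h2, _, he, hT.1, hT.2, ?_⟩
          rw [if_pos ⟨hT.1, by simp [totalSize, h2, hT.2]⟩, pair_comm]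
      · left
        refine ⟨h2, ?_, fun s hs hsT hs1 => ?_⟩
        · rw [if_neg]
          rintro ⟨h5, h6⟩
          simp only [totalSize, sum_singleton, h2] at h6
          exact hT ⟨h5, by omega⟩
        · rcases hcases s hs with h5 | h5
          · exact h4 s h5 hsT hs1
          · exact absurd ⟨h5 ▸ hsT, h5 ▸ hs1⟩ hT
    · right
      refine ⟨f, hf, .inr (.inr ⟨h2, g, hgf, hgT, hg, ?_⟩)⟩
      rw [h3, if_neg]
      rintro ⟨_, h5⟩
      simp only [totalSize, sum_pair hgf.symm, h2, hg] at h5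
      omega

/-- The small items of a set. -/
def smalls (I : KnapsackInstance n) (T : Finset (Fin n)) : Finset (Fin n) :=
  T.filter fun x => I.size x = 1

theorem greedy_subset (I : KnapsackInstance n) (hI : I.IsOneB 2) (T : Finset (Fin n))
    (σ : Equiv.Perm (Fin n)) (t : ℕ) : I.greedy T σ t ⊆ T := by
  rcases I.greedy_cases hI T σ t with ⟨_, h⟩ | ⟨f, hf, ⟨_, h⟩ | ⟨_, h, _⟩ | ⟨_, g, _, hg, _, h⟩⟩ <;>
    rw [h]
  · simp
  · simpa using hf.1
  · simpa using hf.1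
  · intro z hz
    rcases mem_insert.1 hz with rfl | hz
    · exact hf.1
    · rw [mem_singleton.1 hz]; exact hg

theorem mem_greedy_of_large (I : KnapsackInstance n) (hI : I.IsOneB 2) {T : Finset (Fin n)}
    (σ : Equiv.Perm (Fin n)) {x : Fin n} (hx : I.size x = 2) :
    x ∈ I.greedy T σ n ↔ IsFirst T σ x := by
  rcases I.greedy_cases hI T σ n with
    ⟨h1, h⟩ | ⟨f, hf, ⟨_, h⟩ | ⟨hf1, h, _⟩ | ⟨hf1, g, _, _, hg, h⟩⟩ <;> rw [h]
  · simp only [notMem_empty, false_iff]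
    rintro ⟨h2, t, rfl, _⟩
    exact h1 t t.2 h2
  · rw [mem_singleton]
    exact ⟨fun h => h ▸ hf, fun h => h.eq hf⟩
  · rw [mem_singleton]
    exact ⟨fun h => h ▸ hf, fun h => h.eq hf⟩
  · rw [mem_insert, mem_singleton]
    refine ⟨?_, fun h => .inl (h.eq hf)⟩
    rintro (rfl | rfl) <;> omega

/-- If the first item of `T` to arrive is small, then the greedy algorithm packs two small items
of `T`, or the only one. -/
theorem card_smalls_greedy (I : KnapsackInstance n) (hI : I.IsOneB 2) (T : Finset (Fin n))
    (σ : Equiv.Perm (Fin n)) :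
    #((I.smalls T).filter fun x => x ∈ I.greedy T σ n) =
      min 2 #(I.smalls T) * #((I.smalls T).filter fun x => IsFirst T σ x) := by
  have hone : ∀ f, IsFirst T σ f → (I.smalls T).filter (fun x => IsFirst T σ x) =
      (I.smalls T).filter (fun x => x = f) := fun f hf => by
    refine filter_congr fun x _ => ⟨fun h => h.eq hf, fun h => h ▸ hf⟩
  rcases I.greedy_cases hI T σ n with
    ⟨h1, h⟩ | ⟨f, hf, ⟨hf2, h⟩ | ⟨hf1, h, h2⟩ | ⟨hf1, g, hgf, hgT, hg, h⟩⟩ <;> rw [h]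
  · have hT : T = ∅ := eq_empty_of_forall_notMem fun x hx => h1 (σ.symm x) (Fin.is_lt _) (by simpa)
    simp [smalls, hT]
  · rw [hone f hf]
    simp only [mem_singleton, filter_eq']
    rw [if_neg (by simp [smalls, hf2])]
    simp
  · rw [hone f hf]
    have hf' : f ∈ I.smalls T := mem_filter.2 ⟨hf.1, hf1⟩
    have hs : I.smalls T = {f} := by
      refine eq_singleton_iff_unique_mem.2 ⟨hf', fun x hx => ?_⟩
      obtain ⟨hxT, hx1⟩ := mem_filter.1 hx
      have := h2 (σ.symm x) (Fin.is_lt _)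
      simp only [Equiv.apply_symm_apply] at this
      exact this hxT hx1
    simp [hs]
  · rw [hone f hf]
    have hf' : f ∈ I.smalls T := mem_filter.2 ⟨hf.1, hf1⟩
    have hg' : g ∈ I.smalls T := mem_filter.2 ⟨hgT, hg⟩
    have h3 : (I.smalls T).filter (fun x => x ∈ ({f, g} : Finset (Fin n))) = {f, g} := by
      ext x
      simp only [mem_filter, mem_insert, mem_singleton]
      constructor
      · exact fun h => h.2
      · rintro (rfl | rfl)
        · exact ⟨hf', .inl rfl⟩
        · exact ⟨hg', .inr rfl⟩
    have h4 : 2 ≤ #(I.smalls T) := by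
      rw [← card_pair hgf.symm]
      refine card_le_card fun x hx => ?_
      rw [← h3] at hx
      exact (mem_filter.1 hx).1
    rw [h3, card_pair hgf.symm, filter_eq', if_pos hf', card_singleton, min_eq_left h4]

/-- The factor by which the algorithm prefers the item `x` of `T` to a large one: small items can
also be packed in second place if there are two of them. -/
def weight (I : KnapsackInstance n) (T : Finset (Fin n)) (x : Fin n) : ℕ :=
  if I.size x = 1 ∧ 2 ≤ #(I.smalls T) then 2 else 1

theorem card_mul_card_mem_greedy (I : KnapsackInstance n) (hI : I.IsOneB 2) (M : Finset (Fin n))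
    {T : Finset (Fin n)} {x y : Fin n} (hx : x ∈ T) (hy : y ∉ T) :
    #T * #((separating M T y).filter fun σ => x ∈ I.greedy T σ n) =
      I.weight T x * #(separating M T y) := by
  rcases hI x with hx1 | hx2
  swap
  · simp only [weight, hx2, I.mem_greedy_of_large hI _ hx2]
    rw [card_mul_card_isFirst M hx hy]
    simp
  have hxs : x ∈ I.smalls T := mem_filter.2 ⟨hx, hx1⟩
  have hswap : ∀ z ∈ I.smalls T, #((separating M T y).filter fun σ => z ∈ I.greedy T σ n) =
      #((separating M T y).filter fun σ => x ∈ I.greedy T σ n) := by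
    intro z hz
    obtain ⟨hz, hz1⟩ := mem_filter.1 hz
    rw [separating, filter_filter, filter_filter]
    refine card_filter_eq_of_mul_left (Equiv.swap z x) _ _ fun σ => ?_
    have h1 : ∀ t, Equiv.swap z x (σ t) ∈ T ↔ σ t ∈ T :=
      fun t => swap_mem_iff (by simp [hx, hz]) _
    have h3 : ∀ t, Equiv.swap z x (σ t) = y ↔ σ t = y := fun t => by
      rw [← Equiv.eq_symm_apply, Equiv.symm_swap, Equiv.swap_apply_of_ne_of_ne]
      · rintro rfl; exact hy hz
      · rintro rfl; exact hy hx
    rw [I.greedy_swap (by simp [hx, hz]) (by rw [hx1, hz1])]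
    simp [Equiv.Perm.mul_apply, h1, h3]
  have h1 : ∑ z ∈ I.smalls T, #((separating M T y).filter fun σ => z ∈ I.greedy T σ n) =
      min 2 #(I.smalls T) *
        ∑ z ∈ I.smalls T, #((separating M T y).filter fun σ => IsFirst T σ z) := by
    simp_rw [card_filter]
    rw [sum_comm, sum_comm (s := I.smalls T), mul_sum]
    refine sum_congr rfl fun σ _ => ?_
    rw [← card_filter, ← card_filter, I.card_smalls_greedy hI]
  have hpos : 0 < #(I.smalls T) := card_pos.2 ⟨x, hxs⟩
  have hw : I.weight T x = min 2 #(I.smalls T) := by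
    simp only [weight, hx1, true_and]
    split_ifs <;> omega
  refine Nat.eq_of_mul_eq_mul_left hpos ?_
  calc #(I.smalls T) * (#T * #((separating M T y).filter fun σ => x ∈ I.greedy T σ n))
      = #T * ∑ z ∈ I.smalls T, #((separating M T y).filter fun σ => z ∈ I.greedy T σ n) := by
        rw [sum_congr rfl hswap, sum_const, smul_eq_mul]; ring
    _ = min 2 #(I.smalls T) *
        ∑ z ∈ I.smalls T, #T * #((separating M T y).filter fun σ => IsFirst T σ z) := by
        rw [h1, ← mul_sum]; ring
    _ = #(I.smalls T) * (I.weight T x * #(separating M T y)) := by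
        rw [sum_congr rfl fun z (hz : z ∈ I.smalls T) =>
          card_mul_card_isFirst M (mem_filter.1 hz).1 hy, sum_const, smul_eq_mul, hw]
        ring

theorem sum_totalValue_greedy (I : KnapsackInstance n) (hI : I.IsOneB 2) (M : Finset (Fin n))
    {T : Finset (Fin n)} {y : Fin n} (hy : y ∉ T) :
    ∑ σ ∈ separating M T y, I.totalValue (I.greedy T σ n) =
      hitProb n #M #T * ((∑ x ∈ T, I.weight T x * I.value x) / #T) * (n.factorial : ℝ) := by
  have h1 : ∀ σ, I.totalValue (I.greedy T σ n) =
      ∑ x ∈ T, if x ∈ I.greedy T σ n then I.value x else 0 := fun σ => by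
    rw [totalValue, ← sum_filter]
    congr 1
    ext x
    simp only [mem_filter]
    exact ⟨fun h => ⟨I.greedy_subset hI T σ n h, h⟩, fun h => h.2⟩
  simp_rw [h1]
  rw [sum_comm, sum_div, mul_sum, sum_mul]
  refine sum_congr rfl fun x hx => ?_
  rw [← sum_filter, sum_const, nsmul_eq_mul]
  have h2 : (#T : ℝ) * #((separating M T y).filter fun σ => x ∈ I.greedy T σ n) =
      I.weight T x * #(separating M T y) := by
    exact_mod_cast I.card_mul_card_mem_greedy hI M hx hy
  rw [card_separating_eq M hy] at h2
  have hT : (#T : ℝ) ≠ 0 := by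
    have := card_pos.2 ⟨x, hx⟩
    positivity
  field_simp
  linear_combination (I.value x) * h2

/-- Every arrival order has exactly one best sampled item. -/
theorem sum_perm_eq_sum_separating {w : Fin n → ℝ} (hw : Function.Injective w)
    {M : Finset (Fin n)} (hM : M.Nonempty) (F : Equiv.Perm (Fin n) → ℝ) :
    ∑ σ, F σ = ∑ y, ∑ σ ∈ separating M (univ.filter fun z => w y < w z) y, F σ := by
  have h : ∀ y, ∑ σ ∈ separating M (univ.filter fun z => w y < w z) y, F σ =
      ∑ σ, if σ ∈ separating M (univ.filter fun z => w y < w z) y then F σ else 0 := fun y => by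
    rw [← sum_filter]; congr 1; ext; simp
  simp_rw [h]
  rw [sum_comm]
  refine sum_congr rfl fun σ _ => ?_
  obtain ⟨t, ht, hmax⟩ := exists_max_image M (fun t => w (σ t)) hM
  rw [sum_eq_single_of_mem (σ t) (mem_univ _), if_pos]
  · simp only [separating, mem_filter, mem_univ, true_and, not_lt]
    exact ⟨hmax, t, ht, rfl⟩
  · intro y _ hne
    rw [if_neg]
    simp only [separating, mem_filter, mem_univ, true_and, not_lt]
    rintro ⟨h1, s, hs, rfl⟩
    exact hne (hw (le_antisymm (hmax s hs) (h1 t ht)))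

end KnapsackInstance

/-! ### The expected value as a sum over ranks -/

open Classical in
/-- The expected value packed, given that the items with the `j` largest profits are exactly those
exceeding the sample: `v i` is the value of the item of rank `i`, and `S i` says that it is small.
Ranks are counted from `0`. -/
noncomputable def condValue (v : ℕ → ℝ) (S : ℕ → Prop) (j : ℕ) : ℝ :=
  (∑ i ∈ Finset.range j, v i +
    if 2 ≤ ((Finset.range j).filter S).card then ∑ i ∈ (Finset.range j).filter S, v i else 0) / j

namespace KnapsackInstance

variable {n : ℕ}

open Finset

/-- Here `e` lists the items by decreasing boosted profit. -/
theorem expectedValue_eq (I : KnapsackInstance n) (hI : I.IsOneB 2) {α c : ℝ} {M : Finset (Fin n)}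
    (hM : ∀ t, t ∈ M ↔ InSample n c t) (hne : M.Nonempty) (e : Fin n ≃ Fin n)
    (he : StrictAnti (I.boosted α ∘ e)) {v : ℕ → ℝ} {S : ℕ → Prop}
    (hv : ∀ i : Fin n, v i = I.value (e i)) (hS : ∀ i : Fin n, S i ↔ I.size (e i) = 1) :
    I.expectedValue 2 α c = ∑ j ∈ range n, hitProb n #M j * condValue v S j := by
  classical
  have hinj : Function.Injective (I.boosted α) := by
    have := he.injective.comp e.symm.injective
    rwa [Function.comp_assoc, Equiv.self_comp_symm, Function.comp_id] at this
  have hT : ∀ j : Fin n, (univ.filter fun z => I.boosted α (e j) < I.boosted α z) =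
      (univ.filter fun i : Fin n => i < j).map e.toEmbedding := fun j => by
    ext z
    obtain ⟨i, rfl⟩ := e.surjective z
    simp only [mem_filter, mem_univ, true_and, mem_map_equiv, Equiv.symm_apply_apply]
    exact he.lt_iff_gt
  have hsum : ∀ (j : Fin n) (f : ℕ → ℝ) (g : Fin n → ℝ), (∀ i : Fin n, f i = g (e i)) →
      ∑ x ∈ (univ.filter fun i : Fin n => i < j).map e.toEmbedding, g x =
        ∑ i ∈ range j, f i := fun j f g hfg => by
    rw [sum_map]
    refine sum_bij (fun i _ => (i : ℕ)) ?_ (fun a _ b _ h => Fin.ext h) ?_ ?_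
    · intro i hi; simpa using hi
    · intro i hi
      have hi := mem_range.1 hi
      exact ⟨⟨i, hi.trans j.2⟩, mem_filter.2 ⟨mem_univ _, hi⟩, rfl⟩
    · intro i _; exact (hfg i).symm
  rw [expectedValue, sum_perm_eq_sum_separating hinj hne, Fintype.card_perm, Fintype.card_fin,
    div_eq_iff (by positivity), sum_range, sum_mul, ← Equiv.sum_comp e]
  refine sum_congr rfl fun j _ => ?_
  rw [hT j]
  set T := (univ.filter fun i : Fin n => i < j).map e.toEmbedding with hTdef
  have hjT : e j ∉ T := by 
    rw [hTdef, mem_map_equiv, Equiv.symm_apply_apply, mem_filter]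
    exact fun h => lt_irrefl _ h.2
  have hTcard : #T = j := by rw [hTdef, card_map, filter_gt_eq_Iio, Fin.card_Iio]
  have hmem : ∀ z, z ∈ T ↔ I.boosted α (e j) < I.boosted α z := fun z => by
    rw [hTdef, ← hT j]; simp
  rw [sum_congr rfl fun σ hσ => by
    rw [boostedAlg, I.packedAfter_eq_greedy hM hmem hσ], I.sum_totalValue_greedy hI M hjT, hTcard]
  congr 2
  have hcard : ((#(I.smalls T) : ℕ) : ℝ) = #((range j).filter S) := by
    rw [smalls, card_filter, card_filter]
    push_cast
    exact hsum j _ _ fun i => by simp only [hS]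
  have hcard' : #(I.smalls T) = #((range j).filter S) := by exact_mod_cast hcard
  rw [condValue]
  congr 1
  rw [hsum j (fun i => v i + if 2 ≤ #((range j).filter S) then (if S i then v i else 0) else 0) _
    (fun i => ?_), sum_add_distrib]
  · congr 1
    split_ifs
    · rw [sum_filter]
    · simp
  · simp only [weight, hcard', hS, hv]
    by_cases h1 : I.size (e i) = 1 <;> by_cases h2 : 2 ≤ #((range j).filter S) <;>
      simp [h1, h2]
    ring

end KnapsackInstance

/-! ### Convergence to the geometric law -/

theorem missProb_succ (n m j : ℕ) :
    missProb n m (j + 1) = missProb n m j * (1 - (m : ℝ) / ((n : ℝ) - j)) :=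
  Finset.prod_range_succ _ _

theorem missProb_eq_zero {n m j : ℕ} (hm : 0 < m) (hmn : m ≤ n) (hj : n - m < j) :
    missProb n m j = 0 := by
  refine Finset.prod_eq_zero (Finset.mem_range.2 hj) ?_
  rw [Nat.cast_sub hmn, sub_sub_cancel, div_self (by positivity), sub_self]

theorem missProb_bounds {n m : ℕ} (hm : 0 < m) (hmn : m ≤ n) (j : ℕ) :
    0 ≤ missProb n m j ∧ missProb n m j ≤ (1 - (m : ℝ) / n) ^ j := by
  have hm' : (0 : ℝ) < m := by exact_mod_cast hm
  have hmn' : (m : ℝ) ≤ n := by exact_mod_cast hmn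
  have hr : 0 ≤ 1 - (m : ℝ) / n := sub_nonneg.2 (div_le_one_of_le₀ hmn' (by positivity))
  induction j with
  | zero => simp [missProb]
  | succ j ih =>
    by_cases hj : n - m < j + 1
    · rw [missProb_eq_zero hm hmn hj]
      exact ⟨le_rfl, pow_nonneg hr _⟩
    · have hj' : (m : ℝ) + j ≤ n := by exact_mod_cast (by omega : m + j ≤ n)
      have hpos : (0 : ℝ) < n - j := by linarith
      have h1 : 0 ≤ 1 - (m : ℝ) / (n - j) := by
        rw [sub_nonneg, div_le_one hpos]; linarith
      have h2 : 1 - (m : ℝ) / (n - j) ≤ 1 - (m : ℝ) / n := by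
        gcongr
        linarith [(Nat.cast_nonneg j : (0 : ℝ) ≤ j)]
      rw [missProb_succ, pow_succ]
      exact ⟨mul_nonneg ih.1 h1, mul_le_mul ih.2 h2 h1 (pow_nonneg hr _)⟩

theorem hitProb_eq_zero {n m j : ℕ} (hm : 0 < m) (hmn : m ≤ n) (hj : n ≤ j) :
    hitProb n m j = 0 := by
  rw [hitProb, missProb_eq_zero hm hmn (by omega), missProb_eq_zero hm hmn (by omega), sub_self]

theorem abs_hitProb_le {n m : ℕ} (hm : 0 < m) (hmn : m ≤ n) (j : ℕ) :
    |hitProb n m j| ≤ (1 - (m : ℝ) / n) ^ j := by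
  have hmn' : (m : ℝ) ≤ n := by exact_mod_cast hmn
  have hr : 0 ≤ 1 - (m : ℝ) / n := sub_nonneg.2 (div_le_one_of_le₀ hmn' (by positivity))
  have hr' : 1 - (m : ℝ) / n ≤ 1 := sub_le_self _ (by positivity)
  obtain ⟨h1, h2⟩ := missProb_bounds hm hmn j
  obtain ⟨h3, h4⟩ := missProb_bounds hm hmn (j + 1)
  have h5 : (1 - (m : ℝ) / n) ^ (j + 1) ≤ (1 - (m : ℝ) / n) ^ j :=
    pow_le_pow_of_le_one hr hr' (Nat.le_succ j)
  rw [hitProb, abs_le]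
  constructor <;> linarith

/-- The number of sampling rounds. -/
noncomputable def sampleSize (c : ℝ) (n : ℕ) : ℕ := ⌊c * n⌋₊

theorem tendsto_sampleSize_div {c : ℝ} (hc : 0 ≤ c) :
    Tendsto (fun n : ℕ => (sampleSize c n : ℝ) / n) atTop (𝓝 c) :=
  (tendsto_nat_floor_mul_div_atTop hc).comp tendsto_natCast_atTop_atTop

theorem sampleSize_le {c : ℝ} (hc : c ≤ 1) (n : ℕ) : sampleSize c n ≤ n := by
  refine Nat.floor_le_of_le ?_
  exact mul_le_of_le_one_left (Nat.cast_nonneg n) hc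

theorem eventually_sampleSize_pos {c : ℝ} (hc : 0 < c) : ∀ᶠ n in atTop, 0 < sampleSize c n := by
  filter_upwards [(tendsto_sampleSize_div hc.le).eventually (lt_mem_nhds hc)] with n hn
  by_contra h
  simp [Nat.eq_zero_of_not_pos h] at hn

theorem tendsto_missProb {c : ℝ} (hc : 0 < c) (j : ℕ) :
    Tendsto (fun n => missProb n (sampleSize c n) j) atTop (𝓝 ((1 - c) ^ j)) := by
  rw [show (1 - c) ^ j = ∏ _i ∈ Finset.range j, (1 - c) by simp]
  refine tendsto_finsetProd _ fun i _ => Tendsto.sub tendsto_const_nhds ?_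
  have h1 : Tendsto (fun n : ℕ => 1 - (i : ℝ) / n) atTop (𝓝 (1 - 0)) :=
    tendsto_const_nhds.sub (tendsto_const_div_atTop_nhds_zero_nat _)
  have h2 := (tendsto_sampleSize_div hc.le).div h1 (by norm_num)
  rw [sub_zero, div_one] at h2
  refine h2.congr' ?_
  filter_upwards [eventually_gt_atTop i] with n hn
  have hn' : (0 : ℝ) < n := by exact_mod_cast (Nat.zero_le i).trans_lt hn
  have : (i : ℝ) < n := by exact_mod_cast hn
  have h3 : (n : ℝ) - i ≠ 0 := by linarith
  have h4 : 1 - (i : ℝ) / n = (n - i) / n := by field_simp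
  simp only [Pi.div_apply, h4]
  field_simp

/-- The `ℓ¹` distance between the law of the number of items beating the sample and the geometric
law. -/
noncomputable def hitProbDist (c : ℝ) (n : ℕ) : ℝ :=
  ∑' j, |hitProb n (sampleSize c n) j - c * (1 - c) ^ j|

theorem tendsto_hitProbDist {c : ℝ} (hc : 0 < c) (hc1 : c < 1) :
    Tendsto (hitProbDist c) atTop (𝓝 0) := by
  have hbound : Summable fun j => 2 * (1 - c / 2) ^ j :=
    (summable_geometric_of_lt_one (by linarith) (by linarith)).mul_left 2
  have hlim : ∀ j, Tendsto (fun n => |hitProb n (sampleSize c n) j - c * (1 - c) ^ j|) atTop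
      (𝓝 0) := fun j => by
    have h := (tendsto_missProb hc j).sub (tendsto_missProb hc (j + 1))
    rw [show (1 - c) ^ j - (1 - c) ^ (j + 1) = c * (1 - c) ^ j by ring] at h
    have h := (h.sub_const (c * (1 - c) ^ j)).abs
    rwa [sub_self, abs_zero] at h
  have := tendsto_tsum_of_dominated_convergence hbound hlim (by
    filter_upwards [eventually_sampleSize_pos hc, (tendsto_sampleSize_div hc.le).eventually
      (lt_mem_nhds (half_lt_self hc))] with n hn1 hn2 j
    rw [Real.norm_eq_abs, abs_abs]
    have h1 := abs_hitProb_le hn1 (sampleSize_le hc1.le n) j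
    have h2 : (1 - (sampleSize c n : ℝ) / n) ^ j ≤ (1 - c / 2) ^ j := by
      refine pow_le_pow_left₀ (sub_nonneg.2 (div_le_one_of_le₀ ?_ (by positivity))) (by linarith) j
      exact_mod_cast sampleSize_le hc1.le n
    have h3 : |c * (1 - c) ^ j| ≤ (1 - c / 2) ^ j := by
      rw [abs_of_nonneg (mul_nonneg hc.le (pow_nonneg (by linarith) _))]
      calc c * (1 - c) ^ j ≤ 1 * (1 - c / 2) ^ j := by
            refine mul_le_mul hc1.le (pow_le_pow_left₀ (by linarith) (by linarith) j)
              (pow_nonneg (by linarith) _) zero_le_one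
        _ = _ := one_mul _
    rw [abs_le] at h1 h3 ⊢
    constructor <;> linarith)
  simp only [tsum_zero] at this
  exact this

theorem summable_geometric_mul {c B : ℝ} (hc : 0 < c) (hc1 : c < 1) {H : ℕ → ℝ}
    (hH : ∀ j, |H j| ≤ B) : Summable fun j => c * (1 - c) ^ j * H j := by
  refine Summable.of_norm_bounded
    (g := fun j => c * (1 - c) ^ j * B) ?_ fun j => ?_
  · exact ((summable_geometric_of_lt_one (by linarith) (by linarith)).mul_left c).mul_right B
  · have h : 0 ≤ c * (1 - c) ^ j := mul_nonneg hc.le (pow_nonneg (by linarith) _)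
    rw [Real.norm_eq_abs, abs_mul, abs_of_nonneg h]
    exact mul_le_mul_of_nonneg_left (hH j) h

/-- Bounded payoffs have nearly the same expectation under both laws. -/
theorem abs_sum_hitProb_sub_tsum_le {c B : ℝ} (hc : 0 < c) (hc1 : c < 1) {n : ℕ}
    (hn : 0 < sampleSize c n) {H : ℕ → ℝ} (hH : ∀ j, |H j| ≤ B) :
    |∑ j ∈ Finset.range n, hitProb n (sampleSize c n) j * H j - ∑' j, c * (1 - c) ^ j * H j| ≤
      B * hitProbDist c n := by
  have hz : ∀ j ∉ Finset.range n, hitProb n (sampleSize c n) j = 0 := fun j hj =>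
    hitProb_eq_zero hn (sampleSize_le hc1.le n) (by simpa using hj)
  have h1 : Summable fun j => hitProb n (sampleSize c n) j * H j :=
    summable_of_ne_finset_zero (s := Finset.range n) fun j hj => by rw [hz j hj, zero_mul]
  have h2 := summable_geometric_mul hc hc1 hH
  have h3 : Summable fun j => |hitProb n (sampleSize c n) j - c * (1 - c) ^ j| := by
    refine Summable.abs (Summable.sub ?_ ?_)
    · exact summable_of_ne_finset_zero (s := Finset.range n) hz
    · exact (summable_geometric_of_lt_one (by linarith) (by linarith)).mul_left c
  have h4 : ∀ j, ‖hitProb n (sampleSize c n) j * H j - c * (1 - c) ^ j * H j‖ ≤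
      B * |hitProb n (sampleSize c n) j - c * (1 - c) ^ j| := fun j => by
    rw [← sub_mul, Real.norm_eq_abs, abs_mul, mul_comm]
    exact mul_le_mul_of_nonneg_right (hH j) (abs_nonneg _)
  have h5 : ∑' j, hitProb n (sampleSize c n) j * H j =
      ∑ j ∈ Finset.range n, hitProb n (sampleSize c n) j * H j :=
    tsum_eq_sum fun j hj => by rw [hz j hj, zero_mul]
  rw [← h5, ← h1.tsum_sub h2, hitProbDist, ← tsum_mul_left, ← Real.norm_eq_abs]
  exact tsum_of_norm_bounded (h3.mul_left B).hasSum h4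

namespace KnapsackInstance

variable {n : ℕ}

open Classical in
theorem card_inSample {c : ℝ} (hc1 : c ≤ 1) :
    (Finset.univ.filter fun t : Fin n => InSample n c t).card = sampleSize c n := by
  have h : (Finset.univ.filter fun t : Fin n => InSample n c t) =
      Finset.univ.filter fun t : Fin n => (t : ℕ) < sampleSize c n := by
    refine Finset.filter_congr fun t _ => ?_
    rw [InSample, sampleSize, ← Nat.succ_le_iff, Nat.le_floor_iff' (Nat.succ_ne_zero _)]
    push_cast
    rfl
  rw [h, Fin.card_filter_val_lt, min_eq_right (sampleSize_le hc1 n)]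

end KnapsackInstance

theorem condValue_nonneg {v : ℕ → ℝ} (hv : ∀ i, 0 ≤ v i) (S : ℕ → Prop) (j : ℕ) :
    0 ≤ condValue v S j := by
  rw [condValue]
  refine div_nonneg (add_nonneg (Finset.sum_nonneg fun i _ => hv i) ?_) (Nat.cast_nonneg j)
  split_ifs
  · exact Finset.sum_nonneg fun i _ => hv i
  · exact le_rfl

theorem abs_condValue_le {v : ℕ → ℝ} {V : ℝ} (hv : ∀ i, 0 ≤ v i) (hV : ∀ i, v i ≤ V)
    (S : ℕ → Prop) (j : ℕ) : |condValue v S j| ≤ 2 * V := by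
  classical
  have hV0 : 0 ≤ V := (hv 0).trans (hV 0)
  rw [abs_of_nonneg (condValue_nonneg hv S j), condValue]
  refine div_le_of_le_mul₀ (Nat.cast_nonneg j) (by positivity) ?_
  have h1 : ∑ i ∈ Finset.range j, v i ≤ j * V := by
    calc _ ≤ ∑ _i ∈ Finset.range j, V := Finset.sum_le_sum fun i _ => hV i
      _ = _ := by simp
  have h2 : ∑ i ∈ (Finset.range j).filter S, v i ≤ ∑ i ∈ Finset.range j, v i :=
    Finset.sum_le_sum_of_subset_of_nonneg (Finset.filter_subset _ _) fun i _ _ => hv i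
  have h3 : 0 ≤ j * V := by positivity
  split_ifs <;> linarith

/-- The expected value packed, in the limit of many rounds. -/
noncomputable def limitValue (c : ℝ) (v : ℕ → ℝ) (S : ℕ → Prop) : ℝ :=
  ∑' j, c * (1 - c) ^ j * condValue v S j

namespace KnapsackInstance

variable {n : ℕ}

theorem abs_expectedValue_sub_limitValue_le (I : KnapsackInstance n) (hI : I.IsOneB 2) {α c : ℝ}
    (hc : 0 < c) (hc1 : c < 1) (hn : 0 < sampleSize c n) (e : Fin n ≃ Fin n)
    (he : StrictAnti (I.boosted α ∘ e)) {v : ℕ → ℝ} {S : ℕ → Prop} {V : ℝ}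
    (hv0 : ∀ i, 0 ≤ v i) (hV : ∀ i, v i ≤ V)
    (hv : ∀ i : Fin n, v i = I.value (e i)) (hS : ∀ i : Fin n, S i ↔ I.size (e i) = 1) :
    |I.expectedValue 2 α c - limitValue c v S| ≤ 2 * V * hitProbDist c n := by
  classical
  have hcard := card_inSample (n := n) hc1.le
  rw [I.expectedValue_eq hI (M := Finset.univ.filter fun t : Fin n => InSample n c t)
    (fun t => by simp) (Finset.card_pos.1 (by rw [hcard]; exact hn)) e he hv hS, hcard]
  exact abs_sum_hitProb_sub_tsum_le hc hc1 hn (abs_condValue_le hv0 hV S)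

end KnapsackInstance

/-! ### The limiting probabilities of being packed first -/

/-- The limiting probability that the item of rank `i` is the first one to beat the sample, that is
`∑ j > i, c (1 - c) ^ j / j`. -/
noncomputable def firstProb (c : ℝ) (i : ℕ) : ℝ :=
  c * (-Real.log c - ∑ k ∈ Finset.range i, (1 - c) ^ (k + 1) / ((k : ℝ) + 1))

theorem hasSum_firstProb {c : ℝ} (hc : 0 < c) (hc1 : c < 1) (i : ℕ) :
    HasSum (fun j : ℕ => if i < j then c * (1 - c) ^ j / j else 0) (firstProb c i) := by
  have h1 := Real.hasSum_pow_div_log_of_abs_lt_one (x := 1 - c)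
    (by rw [abs_of_pos] <;> linarith)
  rw [sub_sub_cancel] at h1
  have h2 := (hasSum_nat_add_iff' i).2 h1
  have h3 : HasSum (fun j : ℕ => if i < j + (i + 1) then
      c * (1 - c) ^ (j + (i + 1)) / ((j + (i + 1) : ℕ) : ℝ) else 0) (firstProb c i) := by
    refine (congrArg (HasSum · _) (funext fun j => ?_)).mpr (h2.mul_left c)
    rw [if_pos (by omega), mul_div_assoc, ← add_assoc]
    push_cast
    rfl
  have h4 := (hasSum_nat_add_iff (f := fun j : ℕ => if i < j then c * (1 - c) ^ j / j else 0)
    (i + 1)).1 h3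
  rwa [Finset.sum_eq_zero, add_zero] at h4
  intro j hj
  exact if_neg (by have := Finset.mem_range.1 hj; omega)

theorem firstProb_succ (c : ℝ) (i : ℕ) :
    firstProb c (i + 1) = firstProb c i - c * (1 - c) ^ (i + 1) / ((i : ℝ) + 1) := by
  rw [firstProb, firstProb, Finset.sum_range_succ]; ring

theorem firstProb_nonneg {c : ℝ} (hc : 0 < c) (hc1 : c < 1) (i : ℕ) : 0 ≤ firstProb c i := by
  have hx : 0 ≤ 1 - c := by linarith
  refine (hasSum_firstProb hc hc1 i).nonneg fun j => ?_
  split_ifs <;> positivity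

theorem firstProb_antitone {c : ℝ} (hc : 0 < c) (hc1 : c < 1) : Antitone (firstProb c) := by
  have hx : 0 ≤ 1 - c := by linarith
  refine antitone_nat_of_succ_le fun i => ?_
  rw [firstProb_succ]
  have : 0 ≤ c * (1 - c) ^ (i + 1) / ((i : ℝ) + 1) := by positivity
  linarith

/-- Payoffs that depend on the number `j` of items beating the sample through a share `1 / j` of
the values `v i` of the items of rank `i < j`, and of a bonus `u` if `s < j`. -/
theorem hasSum_shares {c : ℝ} (hc : 0 < c) (hc1 : c < 1) (v : ℕ → ℝ) (k s : ℕ) (u : ℝ) :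
    HasSum (fun j : ℕ => c * (1 - c) ^ j *
      ((∑ i ∈ Finset.range k, (if i < j then v i else 0) + if s < j then u else 0) / j))
      (∑ i ∈ Finset.range k, v i * firstProb c i + u * firstProb c s) := by
  have h := (hasSum_sum fun i (_ : i ∈ Finset.range k) =>
    (hasSum_firstProb hc hc1 i).mul_left (v i)).add ((hasSum_firstProb hc hc1 s).mul_left u)
  refine (congrArg (HasSum · _) (funext fun j => ?_)).mpr h
  rw [add_div, mul_add, Finset.sum_div, Finset.mul_sum]
  congr 1
  · refine Finset.sum_congr rfl fun i _ => ?_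
    split_ifs <;> ring
  · split_ifs <;> ring

theorem le_limitValue {c : ℝ} (hc : 0 < c) (hc1 : c < 1) {v : ℕ → ℝ} {V : ℝ}
    (hv0 : ∀ i, 0 ≤ v i) (hV : ∀ i, v i ≤ V) (S : ℕ → Prop) (k s : ℕ) {u : ℝ}
    (h : ∀ j : ℕ, (∑ i ∈ Finset.range k, (if i < j then v i else 0) + if s < j then u else 0) / j ≤
      condValue v S j) :
    ∑ i ∈ Finset.range k, v i * firstProb c i + u * firstProb c s ≤ limitValue c v S := by
  refine hasSum_le (fun j => ?_) (hasSum_shares hc hc1 v k s u)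
    (summable_geometric_mul hc hc1 (abs_condValue_le hv0 hV S)).hasSum
  exact mul_le_mul_of_nonneg_left (h j) (mul_nonneg hc.le (pow_nonneg (by linarith) _))

theorem sum_ite_lt_le_sum_range {v : ℕ → ℝ} (hv0 : ∀ i, 0 ≤ v i) (k j : ℕ) :
    ∑ i ∈ Finset.range k, (if i < j then v i else 0) ≤ ∑ i ∈ Finset.range j, v i := by
  rw [← Finset.sum_filter]
  refine Finset.sum_le_sum_of_subset_of_nonneg (fun i hi => ?_) fun i _ _ => hv0 i
  exact Finset.mem_range.2 (Finset.mem_filter.1 hi).2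

theorem sum_firstProb_le_limitValue {c : ℝ} (hc : 0 < c) (hc1 : c < 1) {v : ℕ → ℝ} {V : ℝ}
    (hv0 : ∀ i, 0 ≤ v i) (hV : ∀ i, v i ≤ V) (S : ℕ → Prop) (k : ℕ) :
    ∑ i ∈ Finset.range k, v i * firstProb c i ≤ limitValue c v S := by
  have := le_limitValue hc hc1 hv0 hV S k 0 (u := 0) fun j => by
    rw [condValue]
    gcongr
    · exact sum_ite_lt_le_sum_range hv0 k j
    · rw [ite_self]
      split_ifs
      · exact Finset.sum_nonneg fun i _ => hv0 i
      · exact le_rfl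
  simpa using this

theorem sum_firstProb_add_le_limitValue {c : ℝ} (hc : 0 < c) (hc1 : c < 1) {v : ℕ → ℝ} {V : ℝ}
    (hv0 : ∀ i, 0 ≤ v i) (hV : ∀ i, v i ≤ V) (S : ℕ → Prop) (k : ℕ) {r s : ℕ} (hrs : r < s)
    (hr : S r) (hs : S s) :
    ∑ i ∈ Finset.range k, v i * firstProb c i + (v r + v s) * firstProb c s ≤
      limitValue c v S := by
  classical
  refine le_limitValue hc hc1 hv0 hV S k s fun j => ?_
  rw [condValue]
  gcongr
  · exact sum_ite_lt_le_sum_range hv0 k j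
  · by_cases hj : s < j
    · have hsub : {r, s} ⊆ (Finset.range j).filter S := by
        intro i hi
        rcases Finset.mem_insert.1 hi with rfl | hi
        · exact Finset.mem_filter.2 ⟨Finset.mem_range.2 (hrs.trans hj), hr⟩
        · rw [Finset.mem_singleton.1 hi]
          exact Finset.mem_filter.2 ⟨Finset.mem_range.2 hj, hs⟩
      have hcard := Finset.card_le_card hsub
      rw [Finset.card_pair hrs.ne] at hcard
      rw [if_pos hj, if_pos hcard, ← Finset.sum_pair hrs.ne]
      exact Finset.sum_le_sum_of_subset_of_nonneg hsub fun i _ _ => hv0 i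
    · rw [if_neg hj]
      split_ifs
      · exact Finset.sum_nonneg fun i _ => hv0 i
      · exact le_rfl

/-! ### Numerical estimates and the threshold -/

theorem firstProb_zero (c : ℝ) : firstProb c 0 = -(c * Real.log c) := by
  simp [firstProb]

theorem firstProb_inv_exp_zero : firstProb (1 / Real.exp 1) 0 = 1 / Real.exp 1 := by
  rw [firstProb_zero, one_div, Real.log_inv, Real.log_exp]; ring

theorem firstProb_zero_lt {c : ℝ} (hc : 0 < c) (hne : c ≠ 1 / Real.exp 1) :
    firstProb c 0 < 1 / Real.exp 1 := by
  have h1 : -1 - Real.log c ≠ 0 := by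
    intro h
    apply hne
    rw [← Real.exp_log hc, show Real.log c = -1 by linarith, Real.exp_neg, one_div]
  have h2 := Real.add_one_lt_exp h1
  rw [Real.exp_sub, Real.exp_log hc, Real.exp_neg] at h2
  rw [firstProb_zero, one_div]
  have h3 := mul_lt_mul_of_pos_left h2 hc
  field_simp at h3 ⊢
  linarith

theorem inv_exp_bounds : 0.3678794411 < 1 / Real.exp 1 ∧ 1 / Real.exp 1 < 0.3678794413 := by
  have h1 := Real.exp_one_gt_d9
  have h2 := Real.exp_one_lt_d9
  have h3 : 0 < Real.exp 1 := Real.exp_pos 1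
  constructor
  · rw [lt_div_iff₀ h3]; linarith
  · rw [div_lt_iff₀ h3]; linarith

theorem inv_exp_pos : 0 < 1 / Real.exp 1 := by positivity

theorem inv_exp_lt_one : 1 / Real.exp 1 < 1 := by linarith [inv_exp_bounds.2]

theorem abs_boostThreshold_sub_lt : |boostThreshold - 1.400382| < 0.0000005 := by
  have h1 := Real.exp_one_gt_d9
  have h2 := Real.exp_one_lt_d9
  obtain ⟨h3, h4⟩ := inv_exp_bounds
  have h5 : 9 / (4 * Real.exp 1) = 9 / 4 * (1 / Real.exp 1) := by ring
  rw [boostThreshold, h5]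
  set x := Real.exp 1 with hx
  set c := 1 / x
  have h6 : 7.389056098 < x ^ 2 := by nlinarith
  have h7 : x ^ 2 < 7.389056101 := by nlinarith
  have h8 : 20.08553691 < x ^ 3 := by nlinarith
  have h9 : x ^ 3 < 20.08553694 := by nlinarith
  have h10 : 0 < 16 - 96 * x + 288 * x ^ 2 - 64 * x ^ 3 := by linarith
  rw [abs_lt]
  constructor
  · rw [lt_sub_iff_add_lt, ← sub_lt_iff_lt_add', lt_div_iff₀ h10]
    nlinarith
  · rw [sub_lt_iff_lt_add, ← lt_sub_iff_add_lt', div_lt_iff₀ h10]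
    nlinarith

theorem boostThreshold_bounds : 1.4003 < boostThreshold ∧ boostThreshold < 1.4004 := by
  have := abs_lt.1 abs_boostThreshold_sub_lt
  constructor <;> linarith

/-- The threshold is tight when the second small item has rank `4` and large items have ranks `1`,
`2`, `3`. -/
theorem firstProb_zero_eq_threshold : firstProb (1 / Real.exp 1) 0 =
    3 * firstProb (1 / Real.exp 1) 4 + boostThreshold *
      (firstProb (1 / Real.exp 1) 1 + firstProb (1 / Real.exp 1) 2 +
        firstProb (1 / Real.exp 1) 3) := by
  have h1 := Real.exp_one_gt_d9
  have h2 := Real.exp_one_lt_d9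
  have h10 : 16 - 96 * Real.exp 1 + 288 * Real.exp 1 ^ 2 - 64 * Real.exp 1 ^ 3 ≠ 0 := by
    have h7 : 7.389 < Real.exp 1 ^ 2 := by nlinarith
    have h9 : Real.exp 1 ^ 3 < 20.0856 := by nlinarith
    intro h
    linarith
  simp only [firstProb_succ _ 3, firstProb_succ _ 2, firstProb_succ _ 1, firstProb_succ _ 0,
    firstProb_inv_exp_zero, boostThreshold]
  have h3 : Real.exp 1 ≠ 0 := (Real.exp_pos 1).ne'
  generalize Real.exp 1 = x at *
  generalize hD : 16 - 96 * x + 288 * x ^ 2 - 64 * x ^ 3 = D at *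
  push_cast
  field_simp
  rw [← hD]
  ring

/-- The tail sum `firstProb s` is at least `2.15` times its first term; the first eight terms
suffice for this. -/
theorem mul_le_firstProb {s : ℕ} (hs : 4 ≤ s) :
    2.15 * ((1 / Real.exp 1) * (1 - 1 / Real.exp 1) ^ (s + 1) / ((s : ℝ) + 1)) ≤
      firstProb (1 / Real.exp 1) s := by
  obtain ⟨h3, h4⟩ := inv_exp_bounds
  have hpos := inv_exp_pos
  have hlt := inv_exp_lt_one
  set c := 1 / Real.exp 1
  set p := c * (1 - c) ^ (s + 1) / ((s : ℝ) + 1) with hp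
  have hx : 0 ≤ 1 - c := by linarith
  have hp0 : 0 ≤ p := by positivity
  have key : ∀ m, ∑ k ∈ Finset.range m, p * ((1 - c) ^ k * (5 / (5 + k))) +
      firstProb c (s + m) ≤ firstProb c s := by
    intro m
    induction m with
    | zero => simp
    | succ m ih =>
      rw [Finset.sum_range_succ, ← add_assoc s, firstProb_succ]
      refine le_trans ?_ ih
      have : p * ((1 - c) ^ m * (5 / (5 + m))) ≤
          c * (1 - c) ^ (s + m + 1) / (((s + m : ℕ) : ℝ) + 1) := by
        have e : c * (1 - c) ^ (s + m + 1) / (((s + m : ℕ) : ℝ) + 1) =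
          p * ((1 - c) ^ m * ((s + 1) / (s + m + 1))) := by
          rw [hp]; push_cast; field_simp; ring
        rw [e]
        have hs' : (4 : ℝ) ≤ s := by exact_mod_cast hs
        have hm : (0 : ℝ) ≤ m := Nat.cast_nonneg m
        refine mul_le_mul_of_nonneg_left (mul_le_mul_of_nonneg_left ?_ (by positivity)) hp0
        rw [div_le_div_iff₀ (by positivity) (by positivity)]
        nlinarith
      linarith
  refine le_trans ?_ (key 8)
  have h8 := firstProb_nonneg hpos hlt (s + 8)
  rw [← Finset.mul_sum, mul_comm]
  have : (2.15 : ℝ) ≤ ∑ k ∈ Finset.range 8, (1 - c) ^ k * (5 / (5 + (k : ℝ))) := by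
    have : ∀ k : ℕ, (0.63212 : ℝ) ^ k * (5 / (5 + (k : ℝ))) ≤ (1 - c) ^ k * (5 / (5 + (k : ℝ))) :=
      fun k => by
        gcongr
        linarith
    refine le_trans ?_ (Finset.sum_le_sum fun k _ => this k)
    simp only [Finset.sum_range_succ, Finset.sum_range_zero]
    norm_num
  nlinarith [mul_le_mul_of_nonneg_left this hp0]

/-- The inequality behind the lower threshold: two small items of about equal value, the better one
of rank `0` and the other one of rank `s`, with large items in between. -/
theorem firstProb_zero_le {α : ℝ} (hα : boostThreshold ≤ α) {s : ℕ} (hs : 1 ≤ s) :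
    firstProb (1 / Real.exp 1) 0 ≤ 3 * firstProb (1 / Real.exp 1) s +
      α * ∑ i ∈ Finset.Ico 1 s, firstProb (1 / Real.exp 1) i := by
  have hθ := boostThreshold_bounds.1
  obtain ⟨h3, h4⟩ := inv_exp_bounds
  have hpos := inv_exp_pos
  have hlt := inv_exp_lt_one
  have htight := firstProb_zero_eq_threshold
  have h0 := firstProb_inv_exp_zero
  set c := 1 / Real.exp 1
  have hn := firstProb_nonneg hpos hlt
  -- Passing from `s` to `s + 1` adds `α * a s - 3 * (a s - a (s + 1))`, which is nonnegative for
  -- `s ≥ 4` because `2.15 * α ≥ 3`.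
  have hs4 : ∀ m, firstProb c 0 ≤ 3 * firstProb c (4 + m) +
      α * ∑ i ∈ Finset.Ico 1 (4 + m), firstProb c i := by
    intro m
    induction m with
    | zero =>
      rw [htight]
      simp only [Finset.sum_Ico_eq_sum_range, Finset.sum_range_succ, Finset.sum_range_zero]
      norm_num
      have := add_nonneg (add_nonneg (hn 1) (hn 2)) (hn 3)
      exact mul_le_mul_of_nonneg_right hα this
    | succ m ih =>
      rw [← add_assoc, Finset.sum_Ico_succ_top (by omega), firstProb_succ]
      have h5 := mul_le_firstProb (s := 4 + m) (by omega)
      have h6 := hn (4 + m)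
      nlinarith
  have e1 := firstProb_succ c 0
  have e2 := firstProb_succ c 1
  have e3 := firstProb_succ c 2
  norm_num at e1 e2 e3
  rw [h0] at e1
  have b1 : 0.1353352 ≤ firstProb c 1 := by rw [e1]; nlinarith
  have b1' : firstProb c 1 ≤ 0.1353354 := by rw [e1]; nlinarith
  have b2 : 0.06183 ≤ firstProb c 2 := by rw [e2]; nlinarith
  have b2' : firstProb c 2 ≤ 0.06185 := by rw [e2]; nlinarith
  have b3 : 0.03086 ≤ firstProb c 3 := by
    have : (1 - c) ^ 3 ≤ 0.632121 ^ 3 := pow_le_pow_left₀ (by linarith) (by linarith) 3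
    rw [e3]; nlinarith
  have hα' : 1.4003 ≤ α := by linarith
  rcases (by omega : s = 1 ∨ s = 2 ∨ s = 3 ∨ 4 ≤ s) with rfl | rfl | rfl | h
  · simp [h0]; linarith
  · simp [h0]; nlinarith
  · simp only [Finset.sum_Ico_eq_sum_range, Finset.sum_range_succ, Finset.sum_range_zero, h0]
    norm_num
    nlinarith
  · obtain ⟨m, rfl⟩ := Nat.exists_eq_add_of_le h
    exact hs4 m

/-! ### Sufficiency -/

namespace KnapsackInstance

variable {n : ℕ}

theorem totalValue_le_opt (I : KnapsackInstance n) {T : Finset (Fin n)} (hT : I.totalSize T ≤ 2) :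
    I.totalValue T ≤ I.opt 2 :=
  Finset.le_sup' I.totalValue (Finset.mem_filter.2 ⟨Finset.mem_univ _, hT⟩)

theorem value_le_opt (I : KnapsackInstance n) (hI : I.IsOneB 2) (x : Fin n) :
    I.value x ≤ I.opt 2 := by
  have h := I.totalValue_le_opt (T := {x}) (by
    rw [totalSize, Finset.sum_singleton]
    rcases hI x with h | h <;> omega)
  rwa [totalValue, Finset.sum_singleton] at h

theorem value_add_value_le_opt (I : KnapsackInstance n) {x y : Fin n} (hxy : x ≠ y)
    (hx : I.size x = 1) (hy : I.size y = 1) : I.value x + I.value y ≤ I.opt 2 := by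
  have h := I.totalValue_le_opt (T := {x, y}) (by
    rw [totalSize, Finset.sum_pair hxy]
    omega)
  rwa [totalValue, Finset.sum_pair hxy] at h

theorem opt_nonneg (I : KnapsackInstance n) : 0 ≤ I.opt 2 := by
  have h := I.totalValue_le_opt (T := ∅) (by simp [totalSize])
  simpa [totalValue] using h

/-- An optimal packing is empty, a single item, or a pair of small items. -/
theorem opt_cases (I : KnapsackInstance n) (hI : I.IsOneB 2) :
    I.opt 2 = 0 ∨ (∃ x, I.opt 2 = I.value x) ∨
      ∃ x y, x ≠ y ∧ I.size x = 1 ∧ I.size y = 1 ∧ I.opt 2 = I.value x + I.value y := by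
  obtain ⟨T, hT, hval⟩ := Finset.exists_mem_eq_sup' (I.packings_nonempty 2) I.totalValue
  have hsize : I.totalSize T ≤ 2 := (Finset.mem_filter.1 hT).2
  have hpos : ∀ x, 1 ≤ I.size x := fun x => by rcases hI x with h | h <;> omega
  have hcard : T.card ≤ 2 := by
    refine le_trans ?_ hsize
    rw [Finset.card_eq_sum_ones]
    exact Finset.sum_le_sum fun x _ => hpos x
  have hopt : I.opt 2 = I.totalValue T := hval
  rcases (by omega : T.card = 0 ∨ T.card = 1 ∨ T.card = 2) with h | h | h
  · left
    rw [hopt, Finset.card_eq_zero.1 h, totalValue, Finset.sum_empty]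
  · right; left
    obtain ⟨x, rfl⟩ := Finset.card_eq_one.1 h
    exact ⟨x, by rw [hopt, totalValue, Finset.sum_singleton]⟩
  · right; right
    obtain ⟨x, y, hxy, rfl⟩ := Finset.card_eq_two.1 h
    rw [totalSize, Finset.sum_pair hxy] at hsize
    have := hpos x
    have := hpos y
    exact ⟨x, y, hxy, by omega, by omega, by rw [hopt, totalValue, Finset.sum_pair hxy]⟩

theorem value_le_boosted (I : KnapsackInstance n) {α : ℝ} (hα : 1 ≤ α) (x : Fin n) :
    I.value x ≤ I.boosted α x := by
  rw [boosted]
  split_ifs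
  · exact le_mul_of_one_le_left (I.value_nonneg x) hα
  · exact le_rfl

theorem boosted_le (I : KnapsackInstance n) {α : ℝ} (hα : 1 ≤ α) (x : Fin n) :
    I.boosted α x ≤ α * I.value x := by
  rw [boosted]
  split_ifs
  · exact le_rfl
  · exact le_mul_of_one_le_left (I.value_nonneg x) hα

theorem boosted_of_small (I : KnapsackInstance n) (α : ℝ) {x : Fin n} (hx : I.size x = 1) :
    I.boosted α x = α * I.value x := if_pos hx

theorem boosted_of_large (I : KnapsackInstance n) (α : ℝ) {x : Fin n} (hx : I.size x = 2) :
    I.boosted α x = I.value x := if_neg (by omega)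

/-- The items can be sorted by decreasing boosted profit. -/
theorem exists_strictAnti (I : KnapsackInstance n) {α : ℝ}
    (h : Function.Injective (I.boosted α)) : ∃ e : Fin n ≃ Fin n, StrictAnti (I.boosted α ∘ e) := by
  let e := Tuple.sort fun i => -I.boosted α i
  refine ⟨e, fun i j hij => ?_⟩
  have h1 := Tuple.monotone_sort (fun i => -I.boosted α i) hij.le
  have h2 : I.boosted α (e j) ≤ I.boosted α (e i) := neg_le_neg_iff.1 h1
  refine lt_of_le_of_ne h2 fun h3 => ?_
  exact hij.ne' (e.injective (h h3))

/-- The value of the item of rank `i` in the order `e`, and `0` beyond the last rank. -/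
noncomputable def rankedValue (I : KnapsackInstance n) (e : Fin n ≃ Fin n) (i : ℕ) : ℝ :=
  if h : i < n then I.value (e ⟨i, h⟩) else 0

theorem rankedValue_val (I : KnapsackInstance n) (e : Fin n ≃ Fin n) (i : Fin n) :
    I.rankedValue e i = I.value (e i) := dif_pos i.2

theorem rankedValue_nonneg (I : KnapsackInstance n) (e : Fin n ≃ Fin n) (i : ℕ) :
    0 ≤ I.rankedValue e i := by
  rw [rankedValue]
  split_ifs
  · exact I.value_nonneg _
  · exact le_rfl

theorem rankedValue_le_opt (I : KnapsackInstance n) (hI : I.IsOneB 2) (e : Fin n ≃ Fin n)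
    (i : ℕ) : I.rankedValue e i ≤ I.opt 2 := by
  rw [rankedValue]
  split_ifs
  · exact I.value_le_opt hI _
  · exact I.opt_nonneg

/-- The item of rank `i` in the order `e` exists and is small. -/
def RankedSmall (I : KnapsackInstance n) (e : Fin n ≃ Fin n) (i : ℕ) : Prop :=
  ∃ h : i < n, I.size (e ⟨i, h⟩) = 1

theorem rankedSmall_val (I : KnapsackInstance n) (e : Fin n ≃ Fin n) (i : Fin n) :
    I.RankedSmall e i ↔ I.size (e i) = 1 := ⟨fun ⟨_, h⟩ => h, fun h => ⟨i.2, h⟩⟩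

end KnapsackInstance

/-- If the values `v i` of ranks `i < s` are at least `α * v s`, except at one rank `r`, then the
value `v r` may be moved to the front, where the weights `a i` are largest. -/
theorem moved_to_front_le {a v : ℕ → ℝ} {α : ℝ} {r s : ℕ} (hα : 1 ≤ α) (ha : Antitone a)
    (ha0 : ∀ i, 0 ≤ a i) (hrs : r < s) (hvrs : v s ≤ v r) (hvr : 0 ≤ v r)
    (hr : ∀ l < r, α * v r ≤ v l) (hs : ∀ l < s, l ≠ r → α * v s ≤ v l) :
    a 0 * v r + α * v s * ∑ i ∈ Finset.Ico 1 s, a i ≤ ∑ i ∈ Finset.range s, v i * a i := by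
  rw [Finset.range_eq_Ico,
    Finset.sum_eq_sum_Ico_succ_bot ((Nat.zero_le r).trans_lt hrs) (fun i => v i * a i), zero_add]
  rcases Nat.eq_zero_or_pos r with rfl | hpos
  · have h1 : α * v s * ∑ i ∈ Finset.Ico 1 s, a i ≤ ∑ i ∈ Finset.Ico 1 s, v i * a i := by
      rw [Finset.mul_sum]
      refine Finset.sum_le_sum fun l hl => ?_
      rw [Finset.mem_Ico] at hl
      exact mul_le_mul_of_nonneg_right (hs l hl.2 (by omega)) (ha0 l)
    linarith
  · have h1 : α * v s * ∑ i ∈ Finset.Ico 1 s, a i + (v r - α * v s) * a r ≤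
        ∑ i ∈ Finset.Ico 1 s, v i * a i := by
      have h2 : (v r - α * v s) * a r =
          ∑ i ∈ Finset.Ico 1 s, if r = i then (v i - α * v s) * a i else 0 := by
        rw [Finset.sum_ite_eq, if_pos (Finset.mem_Ico.2 ⟨hpos, hrs⟩)]
      rw [h2, Finset.mul_sum, ← Finset.sum_add_distrib]
      refine Finset.sum_le_sum fun l hl => ?_
      rw [Finset.mem_Ico] at hl
      split_ifs with h
      · exact le_of_eq (by ring)
      · rw [add_zero]
        exact mul_le_mul_of_nonneg_right (hs l hl.2 (Ne.symm h)) (ha0 l)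
    have h3 : α * v r * a 0 ≤ v 0 * a 0 := mul_le_mul_of_nonneg_right (hr 0 hpos) (ha0 0)
    have h4 : 0 ≤ (α - 1) * v r * (a 0 - a r) :=
      mul_nonneg (mul_nonneg (by linarith) hvr) (by linarith [ha (Nat.zero_le r)])
    have h5 : 0 ≤ α * a r * (v r - v s) :=
      mul_nonneg (mul_nonneg (by linarith) (ha0 r)) (by linarith)
    nlinarith

namespace KnapsackInstance

variable {n : ℕ}

/-- The case that a single item `e i` is an optimal packing. Only the items of ranks `0` and `1`
are needed. -/
theorem single_le_limitValue (I : KnapsackInstance n) (hI : I.IsOneB 2) {α : ℝ} (hα : 1 ≤ α)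
    (hα' : α ≤ Real.exp 1 / (Real.exp 1 - 1)) (e : Fin n ≃ Fin n)
    (he : StrictAnti (I.boosted α ∘ e)) (i : Fin n) (hopt : I.opt 2 = I.value (e i)) :
    1 / Real.exp 1 * I.opt 2 ≤
      limitValue (1 / Real.exp 1) (I.rankedValue e) (I.RankedSmall e) := by
  have hlow := sum_firstProb_le_limitValue inv_exp_pos inv_exp_lt_one (I.rankedValue_nonneg e)
    (I.rankedValue_le_opt hI e) (I.RankedSmall e)
  have h0 := firstProb_inv_exp_zero
  have h1 := firstProb_succ (1 / Real.exp 1) 0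
  obtain ⟨b1, b2⟩ := inv_exp_bounds
  have hαc : α * (1 - 1 / Real.exp 1) ≤ 1 := by
    have h2 : 0 < Real.exp 1 - 1 := by linarith [Real.exp_one_gt_d9]
    have h3 := Real.exp_pos 1
    rw [le_div_iff₀ h2] at hα'
    rw [one_sub_div h3.ne', mul_div_assoc', div_le_one h3]
    exact hα'
  set c := 1 / Real.exp 1
  norm_num at h1
  rw [h0] at h1
  have hc : 0 < c := by linarith
  have hn : 0 < n := i.pos
  have hle : ∀ j : Fin n, j ≤ i → I.boosted α (e i) ≤ I.boosted α (e j) :=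
    fun j hj => he.antitone hj
  let z : Fin n := ⟨0, hn⟩
  have hz : I.rankedValue e 0 = I.value (e z) := I.rankedValue_val e z
  have hwz := hle z (Nat.zero_le _)
  by_cases hfirst : I.value (e i) ≤ I.value (e z)
  · have := hlow 1
    rw [Finset.sum_range_one, hz, h0] at this
    refine le_trans ?_ this
    rw [hopt, mul_comm]
    exact mul_le_mul_of_nonneg_right hfirst hc.le
  have hilarge : I.size (e i) = 2 := (hI (e i)).resolve_left fun h => hfirst <| by
    have h2 := hwz.trans (I.boosted_le hα _)
    rw [I.boosted_of_small α h] at h2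
    exact le_of_mul_le_mul_left h2 (by linarith)
  have hzsmall : I.size (e z) = 1 := (hI (e z)).resolve_right fun h => hfirst <| by
    rw [I.boosted_of_large α h] at hwz
    exact (I.value_le_boosted hα _).trans hwz
  rw [I.boosted_of_large α hilarge, I.boosted_of_small α hzsmall] at hwz
  have hi0 : 1 ≤ (i : ℕ) := by
    rw [Nat.one_le_iff_ne_zero]
    intro h
    have : i = z := Fin.ext h
    exact hfirst (by rw [this])
  let u : Fin n := ⟨1, lt_of_le_of_lt hi0 i.2⟩
  have hu : I.rankedValue e 1 = I.value (e u) := I.rankedValue_val e u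
  have hwu := hle u hi0
  rw [I.boosted_of_large α hilarge] at hwu
  have hvi := I.value_nonneg (e i)
  have hvz := I.value_nonneg (e z)
  rcases hI (e u) with husmall | hularge
  · -- two small items of such profits would be better than `e i`, unless all values vanish
    rw [I.boosted_of_small α husmall] at hwu
    have hzu : e z ≠ e u := fun h => by
      have := congrArg Fin.val (e.injective h)
      simp [z, u] at this
    have h2 := I.value_add_value_le_opt hzu hzsmall husmall
    rw [hopt] at h2
    have h3 : I.value (e i) = 0 := by
      have hα2 : α < 2 := by nlinarith
      nlinarith
    have := hlow 0
    rw [hopt, h3, mul_zero]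
    simpa using this
  · rw [I.boosted_of_large α hularge] at hwu
    have := hlow 2
    rw [Finset.sum_range_succ, Finset.sum_range_one, hz, hu, h0, h1] at this
    refine le_trans ?_ this
    rw [hopt]
    have h2 : (1 - c) * I.value (e i) ≤ I.value (e z) := by
      have h3 : (1 - c) * I.value (e i) ≤ (1 - c) * (α * I.value (e z)) :=
        mul_le_mul_of_nonneg_left hwz (by linarith)
      have h4 : α * (1 - c) * I.value (e z) ≤ 1 * I.value (e z) :=
        mul_le_mul_of_nonneg_right hαc hvz
      linarith
    have h5 : 0 ≤ c * (I.value (e z) - (1 - c) * I.value (e i)) :=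
      mul_nonneg hc.le (by linarith)
    have h6 : 0 ≤ c * c * (I.value (e u) - I.value (e i)) :=
      mul_nonneg (by positivity) (by linarith)
    nlinarith

/-- The case that two small items form an optimal packing. -/
theorem pair_le_limitValue (I : KnapsackInstance n) (hI : I.IsOneB 2) {α : ℝ} (hα : 1 ≤ α)
    (hθ : boostThreshold ≤ α) (e : Fin n ≃ Fin n)
    (he : StrictAnti (I.boosted α ∘ e)) {i j : Fin n} (hij : i < j) (hi : I.size (e i) = 1)
    (hj : I.size (e j) = 1) (hopt : I.opt 2 = I.value (e i) + I.value (e j)) :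
    1 / Real.exp 1 * I.opt 2 ≤
      limitValue (1 / Real.exp 1) (I.rankedValue e) (I.RankedSmall e) := by
  have hlow := sum_firstProb_add_le_limitValue inv_exp_pos inv_exp_lt_one (I.rankedValue_nonneg e)
    (I.rankedValue_le_opt hI e) (I.RankedSmall e) (j + 1) (r := i) (s := j) hij
    ((I.rankedSmall_val e i).2 hi) ((I.rankedSmall_val e j).2 hj)
  have hαpos : 0 < α := by linarith
  have hwi := I.boosted_of_small α hi
  have hwj := I.boosted_of_small α hj
  have hvj : I.rankedValue e j ≤ I.rankedValue e i := by
    have h1 : I.boosted α (e j) < I.boosted α (e i) := he hij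
    rw [hwi, hwj] at h1
    rw [rankedValue_val, rankedValue_val]
    exact (lt_of_mul_lt_mul_left h1 hαpos.le).le
  -- another small item ahead of `e j` would form a better pair with `e i`
  have hlarge : ∀ l : Fin n, l < j → l ≠ i → I.boosted α (e l) = I.value (e l) := by
    intro l hlj hli
    refine I.boosted_of_large α ((hI (e l)).resolve_left fun h => ?_)
    have h1 := I.value_add_value_le_opt (e.injective.ne hli) h hi
    have h2 : I.boosted α (e j) < I.boosted α (e l) := he hlj
    rw [hwj, I.boosted_of_small α h] at h2
    have := lt_of_mul_lt_mul_left h2 hαpos.le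
    linarith
  have hfront := moved_to_front_le (v := I.rankedValue e) hα
    (firstProb_antitone inv_exp_pos inv_exp_lt_one)
    (firstProb_nonneg inv_exp_pos inv_exp_lt_one) (r := i) (s := j) hij hvj
    (I.rankedValue_nonneg e i)
    (fun l hl => by
      have hl' : (⟨l, hl.trans i.2⟩ : Fin n) < i := hl
      have h1 : I.boosted α (e i) < I.boosted α (e ⟨l, hl.trans i.2⟩) := he hl'
      rw [hwi, hlarge _ (hl'.trans hij) hl'.ne] at h1
      rw [rankedValue_val, rankedValue, dif_pos (hl.trans i.2)]
      exact h1.le)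
    (fun l hl hne => by
      have hl' : (⟨l, hl.trans j.2⟩ : Fin n) < j := hl
      have h1 : I.boosted α (e j) < I.boosted α (e ⟨l, hl.trans j.2⟩) := he hl'
      rw [hwj, hlarge _ hl' fun h => hne (congrArg Fin.val h)] at h1
      rw [rankedValue_val, rankedValue, dif_pos (hl.trans j.2)]
      exact h1.le)
  have hkey := firstProb_zero_le hθ (s := j) (by have : (i : ℕ) < j := hij; omega)
  have hmul := mul_le_mul_of_nonneg_left hkey (I.rankedValue_nonneg e j)
  rw [Finset.sum_range_succ] at hlow
  rw [firstProb_inv_exp_zero] at hfront hmul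
  rw [hopt, ← rankedValue_val, ← rankedValue_val]
  have hsub := mul_le_mul_of_nonneg_right hvj
    (firstProb_nonneg inv_exp_pos inv_exp_lt_one j)
  nlinarith

theorem opt_le_limitValue (I : KnapsackInstance n) (hI : I.IsOneB 2) {α : ℝ} (hα : 1 ≤ α)
    (hθ : boostThreshold ≤ α) (hα' : α ≤ Real.exp 1 / (Real.exp 1 - 1)) (e : Fin n ≃ Fin n)
    (he : StrictAnti (I.boosted α ∘ e)) :
    1 / Real.exp 1 * I.opt 2 ≤
      limitValue (1 / Real.exp 1) (I.rankedValue e) (I.RankedSmall e) := by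
  rcases I.opt_cases hI with h | ⟨x, h⟩ | ⟨x, y, hxy, hx, hy, h⟩
  · have := sum_firstProb_le_limitValue inv_exp_pos inv_exp_lt_one (I.rankedValue_nonneg e)
      (I.rankedValue_le_opt hI e) (I.RankedSmall e) 0
    rw [h, mul_zero]
    simpa using this
  · exact I.single_le_limitValue hI hα hα' e he (e.symm x) (by simpa using h)
  · rcases lt_or_gt_of_ne (e.symm.injective.ne hxy) with hlt | hlt
    · exact I.pair_le_limitValue hI hα hθ e he hlt (by simpa using hx) (by simpa using hy)
        (by simpa using h)
    · exact I.pair_le_limitValue hI hα hθ e he hlt (by simpa using hy) (by simpa using hx)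
        (by simpa [add_comm] using h)

theorem expectedValue_nonneg (I : KnapsackInstance n) (α c : ℝ) : 0 ≤ I.expectedValue 2 α c :=
  div_nonneg (Finset.sum_nonneg fun _ _ => Finset.sum_nonneg fun i _ => I.value_nonneg i)
    (Nat.cast_nonneg _)

end KnapsackInstance

theorem isAsymptoticallyCompetitive {α : ℝ} (hα : 1 ≤ α) (hθ : boostThreshold ≤ α)
    (hα' : α ≤ Real.exp 1 / (Real.exp 1 - 1)) :
    IsAsymptoticallyCompetitive α (1 / Real.exp 1) (1 / Real.exp 1) := by
  have hc := inv_exp_pos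
  have hc1 := inv_exp_lt_one
  -- With an empty sample the error term is `1 / e`, so that the claim is void.
  refine ⟨fun n => if 0 < sampleSize (1 / Real.exp 1) n then
    2 * hitProbDist (1 / Real.exp 1) n else 1 / Real.exp 1, ?_, ?_⟩
  · have h := (tendsto_hitProbDist hc hc1).const_mul 2
    rw [mul_zero] at h
    refine h.congr' ?_
    filter_upwards [eventually_sampleSize_pos hc] with n hn
    rw [if_pos hn]
  · intro n I hI _ hinj
    dsimp only
    split_ifs with hn
    · obtain ⟨e, he⟩ := I.exists_strictAnti hinj
      have h1 := I.abs_expectedValue_sub_limitValue_le hI hc hc1 hn e he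
        (I.rankedValue_nonneg e) (I.rankedValue_le_opt hI e) (I.rankedValue_val e)
        (I.rankedSmall_val e)
      have h2 := I.opt_le_limitValue hI hα hθ hα' e he
      have h3 := (abs_le.1 h1).1
      linarith
    · rw [sub_self, zero_mul]
      exact I.expectedValue_nonneg _ _

/-! ### Necessity -/

/-- Upper bound for the limit when the values of rank at least `k` add up to at most `ε` and the
second packed item contributes at most `u`, and only if more than `s` items beat the sample. -/
theorem limitValue_le {c : ℝ} (hc : 0 < c) (hc1 : c < 1) {v : ℕ → ℝ} {S : ℕ → Prop} {V : ℝ}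
    (hv0 : ∀ i, 0 ≤ v i) (hV : ∀ i, v i ≤ V) {k s : ℕ} {ε u : ℝ}
    (htail : ∀ j, ∑ i ∈ Finset.range j, v i ≤
      ∑ i ∈ Finset.range k, (if i < j then v i else 0) + ε)
    (hbonus : ∀ j, condValue v S j ≤
      (∑ i ∈ Finset.range j, v i + if s < j then u else 0) / j) :
    limitValue c v S ≤
      ∑ i ∈ Finset.range k, v i * firstProb c i + ε * firstProb c 0 + u * firstProb c s := by
  have h := (hasSum_shares hc hc1 v k s u).add (hasSum_shares hc hc1 v 0 0 ε)
  rw [Finset.sum_range_zero, zero_add, add_right_comm] at h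
  refine hasSum_le (fun j => ?_)
    (summable_geometric_mul hc hc1 (abs_condValue_le hv0 hV S)).hasSum h
  rw [← mul_add]
  refine mul_le_mul_of_nonneg_left ?_ (mul_nonneg hc.le (pow_nonneg (by linarith) _))
  refine (hbonus j).trans ?_
  rw [← add_div, Finset.sum_range_zero, zero_add]
  rcases Nat.eq_zero_or_pos j with rfl | hj
  · simp
  · rw [if_pos hj]
    refine div_le_div_of_nonneg_right ?_ (Nat.cast_nonneg j)
    linarith [htail j]

/-- With at most one small item there is no second packed item. -/
theorem condValue_le_of_forall_eq {v : ℕ → ℝ} {S : ℕ → Prop} {r : ℕ} (hS : ∀ i, S i → i = r)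
    (j : ℕ) : condValue v S j ≤ (∑ i ∈ Finset.range j, v i + if 0 < j then (0 : ℝ) else 0) / j := by
  classical
  have h : ((Finset.range j).filter S).card ≤ 1 := Finset.card_le_one.2 fun a ha b hb => by
    rw [hS a (Finset.mem_filter.1 ha).2, hS b (Finset.mem_filter.1 hb).2]
  rw [condValue, if_neg (by convert (by omega : ¬ 2 ≤ ((Finset.range j).filter S).card)), ite_self]

theorem condValue_le_of_forall_eq_or_eq {v : ℕ → ℝ} (hv0 : ∀ i, 0 ≤ v i) {S : ℕ → Prop}
    {r s : ℕ} (hrs : r < s) (hS : ∀ i, S i → i = r ∨ i = s) (j : ℕ) :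
    condValue v S j ≤ (∑ i ∈ Finset.range j, v i + if s < j then v r + v s else 0) / j := by
  classical
  rw [condValue]
  gcongr
  by_cases hj : s < j
  · rw [if_pos hj]
    split_ifs
    · rw [← Finset.sum_pair hrs.ne]
      refine Finset.sum_le_sum_of_subset_of_nonneg (fun i hi => ?_) fun i _ _ => hv0 i
      simpa using hS i (Finset.mem_filter.1 hi).2
    · exact add_nonneg (hv0 r) (hv0 s)
  · have h : ((Finset.range j).filter S).card ≤ 1 := by
      have key : ∀ a ∈ (Finset.range j).filter S, a = r := fun a ha => by
        obtain ⟨h1, h2⟩ := Finset.mem_filter.1 ha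
        have h1 := Finset.mem_range.1 h1
        rcases hS a h2 with h | h <;> omega
      exact Finset.card_le_one.2 fun a ha b hb => by rw [key a ha, key b hb]
    rw [if_neg hj, if_neg (by omega)]

/-- The instance consisting of the first `n` items of a sequence of items. -/
def prefixInstance (v : ℕ → ℝ) (z : ℕ → ℕ) (hv : ∀ i, 0 ≤ v i) (n : ℕ) : KnapsackInstance n where
  value i := v i
  size i := z i
  value_nonneg i := hv i

/-- Competitiveness passes to the limit along the prefixes of a fixed sequence of items. -/
theorem IsAsymptoticallyCompetitive.le_limitValue {α c ρ : ℝ}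
    (h : IsAsymptoticallyCompetitive α c ρ) (hρ : 0 < ρ) (hc : 0 < c) (hc1 : c < 1)
    {v : ℕ → ℝ} {z : ℕ → ℕ} {V W : ℝ} (hv : ∀ i, 0 ≤ v i) (hV : ∀ i, v i ≤ V)
    (hz : ∀ i, z i = 1 ∨ z i = 2) (hinj : Function.Injective v)
    (hanti : StrictAnti fun i => if z i = 1 then α * v i else v i)
    (hW : ∀ᶠ n in atTop, W ≤ (prefixInstance v z hv n).opt 2) :
    ρ * W ≤ limitValue c v fun i => z i = 1 := by
  obtain ⟨δ, hδ, hcomp⟩ := h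
  have hstrict : ∀ n, StrictAnti ((prefixInstance v z hv n).boosted α ∘ Equiv.refl (Fin n)) :=
    fun n i j hij => hanti (a := (i : ℕ)) (b := (j : ℕ)) hij
  have hone : ∀ n, (prefixInstance v z hv n).IsOneB 2 := fun n i => hz i
  have hlim : Tendsto (fun n => (prefixInstance v z hv n).expectedValue 2 α c) atTop
      (𝓝 (limitValue c v fun i => z i = 1)) := by
    rw [tendsto_iff_dist_tendsto_zero]
    have h0 := (tendsto_hitProbDist hc hc1).const_mul (2 * V)
    rw [mul_zero] at h0
    refine squeeze_zero' (Eventually.of_forall fun _ => dist_nonneg) ?_ h0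
    filter_upwards [eventually_sampleSize_pos hc] with n hn
    exact (prefixInstance v z hv n).abs_expectedValue_sub_limitValue_le (hone n) hc hc1 hn
      (Equiv.refl _) (hstrict n) hv hV (fun _ => rfl) (fun _ => Iff.rfl)
  have hleft : Tendsto (fun n => (ρ - δ n) * W) atTop (𝓝 (ρ * W)) := by
    have := (tendsto_const_nhds (x := ρ)).sub hδ
    rw [sub_zero] at this
    exact this.mul_const W
  refine le_of_tendsto_of_tendsto hleft hlim ?_
  filter_upwards [hW, hδ.eventually (gt_mem_nhds hρ)] with n hn hδn
  refine le_trans (mul_le_mul_of_nonneg_left hn (by linarith)) ?_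
  exact hcomp n _ (hone n) (fun i j hij => Fin.ext (hinj hij)) (hstrict n).injective

/-- The values `v i` for `i < k`, followed by values of total at most `ε`. -/
noncomputable def paddedValue (k : ℕ) (v : ℕ → ℝ) (ε : ℝ) (i : ℕ) : ℝ :=
  if i < k then v i else ε * (1 / 2) ^ (i + 1)

/-- The sizes `z i` for `i < k`, followed by sizes `2`. -/
def paddedSize (k : ℕ) (z : ℕ → ℕ) (i : ℕ) : ℕ := if i < k then z i else 2

theorem padding_lt {ε : ℝ} (hε : 0 < ε) {i j : ℕ} (hij : i < j) :
    ε * (1 / 2) ^ (j + 1) < ε * (1 / 2) ^ (i + 1) :=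
  mul_lt_mul_of_pos_left
    (pow_lt_pow_right_of_lt_one₀ (by norm_num) (by norm_num) (by omega)) hε

theorem padding_lt_self {ε : ℝ} (hε : 0 < ε) (i : ℕ) : ε * (1 / 2) ^ (i + 1) < ε :=
  mul_lt_of_lt_one_right hε (pow_lt_one₀ (by norm_num) (by norm_num) (by omega))

theorem sum_padding_le {ε : ℝ} (hε : 0 < ε) (s : Finset ℕ) :
    ∑ i ∈ s, ε * (1 / 2) ^ (i + 1) ≤ ε := by
  have h : HasSum (fun i : ℕ => ε * (1 / 2 : ℝ) ^ (i + 1)) ε := by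
    have := (hasSum_geometric_two' ε)
    refine (congrArg (HasSum · _) (funext fun i => ?_)).mpr this
    rw [pow_succ, div_pow, one_pow]
    ring
  exact sum_le_hasSum s (fun i _ => by positivity) h

/-- The necessary condition obtained from finitely many items of comparable values in a sea of
large items of small total value `ε`. -/
theorem IsAsymptoticallyCompetitive.le_sum_firstProb {α c ρ : ℝ}
    (h : IsAsymptoticallyCompetitive α c ρ) (hρ : 0 < ρ) (hα : 1 ≤ α) (hc : 0 < c) (hc1 : c < 1)
    {k s : ℕ} {v : ℕ → ℝ} {z : ℕ → ℕ} {ε u W : ℝ} (hε : 0 < ε) (hvε : ∀ i < k, ε ≤ v i)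
    (hz : ∀ i < k, z i = 1 ∨ z i = 2) (hinj : ∀ i < k, ∀ j < k, v i = v j → i = j)
    (hanti : ∀ i, i + 1 < k → (if z (i + 1) = 1 then α * v (i + 1) else v (i + 1)) <
      if z i = 1 then α * v i else v i)
    (hbonus : ∀ j, condValue (paddedValue k v ε) (fun i => paddedSize k z i = 1) j ≤
      (∑ i ∈ Finset.range j, paddedValue k v ε i + if s < j then u else 0) / j)
    (hW : ∀ n (I : KnapsackInstance n), I.IsOneB 2 → k ≤ n →
      (∀ i : Fin n, (i : ℕ) < k → I.value i = v i ∧ I.size i = z i) → W ≤ I.opt 2) :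
    ρ * W ≤ ∑ i ∈ Finset.range k, v i * firstProb c i + ε * firstProb c 0 + u * firstProb c s := by
  have hpos : ∀ i, 0 < paddedValue k v ε i := fun i => by
    rw [paddedValue]
    split_ifs with hi
    · exact hε.trans_le (hvε i hi)
    · positivity
  have hv : ∀ i, 0 ≤ paddedValue k v ε i := fun i => (hpos i).le
  have hin : ∀ i < k, paddedValue k v ε i = v i := fun i hi => if_pos hi
  have hout : ∀ i, ¬ i < k → paddedValue k v ε i = ε * (1 / 2) ^ (i + 1) := fun i hi => if_neg hi
  have hV : ∀ i, paddedValue k v ε i ≤ ∑ i ∈ Finset.range k, v i + ε := fun i => by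
    have h0 : ∀ i ∈ Finset.range k, 0 ≤ v i := fun i hi =>
      hε.le.trans (hvε i (Finset.mem_range.1 hi))
    by_cases hi : i < k
    · rw [hin i hi]
      linarith [Finset.single_le_sum h0 (Finset.mem_range.2 hi)]
    · rw [hout i hi]
      linarith [Finset.sum_nonneg h0, padding_lt_self hε i]
  have hz' : ∀ i, paddedSize k z i = 1 ∨ paddedSize k z i = 2 := fun i => by
    rw [paddedSize]
    split_ifs with hi
    · exact hz i hi
    · exact .inr rfl
  have hinj' : Function.Injective (paddedValue k v ε) := by
    intro i j hij
    by_cases hi : i < k <;> by_cases hj : j < k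
    · rw [hin i hi, hin j hj] at hij
      exact hinj i hi j hj hij
    · rw [hin i hi, hout j hj] at hij
      linarith [hvε i hi, padding_lt_self hε j]
    · rw [hout i hi, hin j hj] at hij
      linarith [hvε j hj, padding_lt_self hε i]
    · rw [hout i hi, hout j hj] at hij
      rcases lt_trichotomy i j with hlt | hlt | hlt
      · linarith [padding_lt hε hlt]
      · exact hlt
      · linarith [padding_lt hε hlt]
  have hlarge : ∀ i, ¬ i < k → ¬ paddedSize k z i = 1 := fun i hi => by simp [paddedSize, hi]
  have hanti' : StrictAnti fun i => if paddedSize k z i = 1 then α * paddedValue k v ε i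
      else paddedValue k v ε i := by
    refine strictAnti_nat_of_succ_lt fun i => ?_
    by_cases hi1 : i + 1 < k
    · simp only [paddedSize, paddedValue, if_pos hi1, if_pos (Nat.lt_of_succ_lt hi1)]
      exact hanti i hi1
    · simp only [hout _ hi1, if_neg (hlarge _ hi1)]
      by_cases hi : i < k
      · have h1 := hvε i hi
        have h2 := padding_lt_self hε (i + 1)
        rw [hin i hi]
        split_ifs
        all_goals nlinarith
      · rw [if_neg (hlarge i hi), hout i hi]
        exact padding_lt hε (Nat.lt_succ_self i)
  have hlim := h.le_limitValue hρ hc hc1 hv hV hz' hinj' hanti' (W := W) (by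
    filter_upwards [eventually_ge_atTop k] with n hn
    exact hW n _ (fun i => hz' i) hn fun i hi => ⟨if_pos hi, if_pos hi⟩)
  refine hlim.trans ?_
  have hup := limitValue_le hc hc1 hv hV (k := k) (ε := ε) (fun j => ?_) hbonus
  · refine hup.trans (le_of_eq ?_)
    congr 2
    exact Finset.sum_congr rfl fun i hi => by rw [hin i (Finset.mem_range.1 hi)]
  · rw [← Finset.sum_filter, ← Finset.sum_filter_add_sum_filter_not (Finset.range j) (· < k)]
    refine add_le_add (le_of_eq (Finset.sum_congr ?_ fun _ _ => rfl)) ?_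
    · ext i
      simp only [Finset.mem_filter, Finset.mem_range]
      exact and_comm
    · refine le_trans (le_of_eq ?_) (sum_padding_le hε ((Finset.range j).filter (¬ · < k)))
      exact Finset.sum_congr rfl fun i hi => hout i (Finset.mem_filter.1 hi).2

theorem le_of_forall_small_le_add_mul {X Y K ε₀ : ℝ} (hε₀ : 0 < ε₀)
    (h : ∀ ε, 0 < ε → ε < ε₀ → Y ≤ X + ε * K) : Y ≤ X := by
  have hlim : Tendsto (fun ε : ℝ => X + ε * K) (𝓝[>] 0) (𝓝 (X + 0 * K)) :=
    (Continuous.tendsto (by fun_prop) 0).mono_left nhdsWithin_le_nhds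
  rw [zero_mul, add_zero] at hlim
  refine ge_of_tendsto hlim ?_
  filter_upwards [Ioo_mem_nhdsGT hε₀] with ε hε
  exact h ε hε.1 hε.2

/-- One large item dominates: the classical secretary problem. -/
theorem IsAsymptoticallyCompetitive.sample_eq {α c : ℝ} (hα : 1 ≤ α) (hc : 0 < c) (hc1 : c < 1)
    (h : IsAsymptoticallyCompetitive α c (1 / Real.exp 1)) : c = 1 / Real.exp 1 := by
  by_contra hne
  refine absurd (firstProb_zero_lt hc hne) (not_lt.2 ?_)
  refine le_of_forall_small_le_add_mul (K := firstProb c 0) zero_lt_one fun ε hε hε1 => ?_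
  have := h.le_sum_firstProb inv_exp_pos hα hc hc1 (k := 1) (s := 0) (u := 0) (W := 1)
    (v := fun _ => 1) (z := fun _ => 2) hε (fun _ _ => hε1.le) (fun _ _ => .inr rfl)
    (fun i hi j hj _ => by omega) (fun i hi => by omega)
    (condValue_le_of_forall_eq (r := 0) fun i hi => by simp [paddedSize] at hi)
    (fun n I hI hn hIv => by
      have h0 := (hIv ⟨0, hn⟩ Nat.zero_lt_one).1
      rw [← h0]
      exact I.value_le_opt hI _)
  simpa using this

/-- A small item whose boosted profit is just above the profit of a large item. -/
theorem IsAsymptoticallyCompetitive.boost_le {α : ℝ} (hα : 1 ≤ α)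
    (h : IsAsymptoticallyCompetitive α (1 / Real.exp 1) (1 / Real.exp 1)) :
    α ≤ Real.exp 1 / (Real.exp 1 - 1) := by
  have he := Real.exp_one_gt_d9
  rcases hα.eq_or_lt with rfl | hα1
  · rw [le_div_iff₀ (by linarith)]; linarith
  have hα0 : 0 < α := by linarith
  have key : 1 / Real.exp 1 * 1 ≤ 1 / α * firstProb (1 / Real.exp 1) 0 +
      firstProb (1 / Real.exp 1) 1 := by
    -- The small item has value `(1 + ε) / α`, which has to lie between `ε` and `1`.
    refine le_of_forall_small_le_add_mul (ε₀ := min (α - 1) (1 / α))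
      (K := (1 / α + 1) * firstProb (1 / Real.exp 1) 0)
      (lt_min (by linarith) (by positivity)) fun ε hε hε1 => ?_
    obtain ⟨hε1, hε2⟩ := lt_min_iff.1 hε1
    have hlt : (1 + ε) / α < 1 := by rw [div_lt_one hα0]; linarith
    have := h.le_sum_firstProb inv_exp_pos hα inv_exp_pos inv_exp_lt_one
      (k := 2) (s := 0) (u := 0) (W := 1)
      (v := fun i => if i = 0 then (1 + ε) / α else 1) (z := fun i => if i = 0 then 1 else 2) hε
      (fun i _ => by
        have h1 : 1 / α ≤ (1 + ε) / α := by gcongr; linarith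
        split_ifs <;> linarith)
      (fun i _ => by split_ifs <;> simp)
      (fun i hi j hj hij => by
        interval_cases i <;> interval_cases j <;> simp at hij ⊢ <;> linarith)
      (fun i hi => by
        obtain rfl : i = 0 := by omega
        simp only [Nat.reduceAdd, one_ne_zero, if_true, if_false]
        rw [if_neg (by norm_num), mul_div_cancel₀ _ hα0.ne']
        linarith)
      (condValue_le_of_forall_eq (r := 0) fun i hi => by
        by_contra hne
        simp [paddedSize, hne] at hi)
      (fun n I hI hn hIv => by
        have h0 := (hIv ⟨1, hn⟩ Nat.one_lt_two).1
        simp only [one_ne_zero, if_false] at h0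
        rw [← h0]
        exact I.value_le_opt hI _)
    refine this.trans (le_of_eq ?_)
    simp only [Finset.sum_range_succ, Finset.sum_range_zero, one_ne_zero, if_true, if_false]
    ring
  have h1 := firstProb_succ (1 / Real.exp 1) 0
  rw [firstProb_inv_exp_zero] at key h1
  rw [h1] at key
  have hpos := inv_exp_pos
  have hcexp : 1 / Real.exp 1 * Real.exp 1 = 1 := one_div_mul_cancel (Real.exp_pos 1).ne'
  set c := 1 / Real.exp 1
  have h2 : c * (1 - c) ≤ c * (1 / α) := by
    norm_num at key ⊢
    linarith
  have h3 : 1 - c ≤ 1 / α := le_of_mul_le_mul_left h2 hpos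
  rw [le_div_iff₀ hα0] at h3
  rw [le_div_iff₀ (by linarith)]
  have h4 := mul_le_mul_of_nonneg_right h3 (Real.exp_pos 1).le
  nlinarith

/-- Two small items of about equal value, whose boosted profits enclose those of three large
items. -/
theorem IsAsymptoticallyCompetitive.boostThreshold_le {α : ℝ} (hα : 1 ≤ α)
    (h : IsAsymptoticallyCompetitive α (1 / Real.exp 1) (1 / Real.exp 1)) :
    boostThreshold ≤ α := by
  have hα0 : 0 < α := by linarith
  -- The values stay distinct: for `α > 1` the better small value `1 + 4 ε` lies below all large
  -- ones.
  obtain ⟨ε₀, hε₀, hgap⟩ : ∃ ε₀ : ℝ, 0 < ε₀ ∧ ∀ ε < ε₀, α = 1 ∨ 1 + 4 * ε < α := by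
    rcases hα.eq_or_lt with rfl | hα1
    · exact ⟨1, one_pos, fun _ _ => .inl rfl⟩
    · exact ⟨(α - 1) / 4, by linarith, fun ε hε => .inr (by linarith)⟩
  set a := firstProb (1 / Real.exp 1) with ha
  have key : 1 / Real.exp 1 * 2 ≤ a 0 + α * (a 1 + a 2 + a 3) + 3 * a 4 := by
    refine le_of_forall_small_le_add_mul (ε₀ := min ε₀ 1)
      (K := 5 * a 0 + α * (3 * a 1 + 2 * a 2 + a 3) + 4 * a 4)
      (lt_min hε₀ one_pos) fun ε hε hε1 => ?_
    obtain ⟨hε1, hε2⟩ := lt_min_iff.1 hε1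
    have hαε : 0 < α * ε := mul_pos hα0 hε
    let v : ℕ → ℝ := fun i =>
      if i = 0 then 1 + 4 * ε else if i = 4 then 1 else α * (1 + (4 - i) * ε)
    let z : ℕ → ℕ := fun i => if i = 0 ∨ i = 4 then 1 else 2
    have v0 : v 0 = 1 + 4 * ε := rfl
    have v1 : v 1 = α + 3 * (α * ε) := by simp [v]; ring
    have v2 : v 2 = α + 2 * (α * ε) := by simp [v]; ring
    have v3 : v 3 = α + α * ε := by simp [v]; ring
    have v4 : v 4 = 1 := rfl
    have hvε : ∀ i < 5, ε ≤ v i := fun i hi => by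
      interval_cases i <;> simp only [v0, v1, v2, v3, v4] <;> linarith
    have := h.le_sum_firstProb inv_exp_pos hα inv_exp_pos inv_exp_lt_one
      (k := 5) (s := 4) (u := paddedValue 5 v ε 0 + paddedValue 5 v ε 4) (W := 2)
      (v := v) (z := z) hε hvε
      (fun i _ => by simp only [z]; split_ifs <;> simp)
      (fun i hi j hj hij => by
        rcases hgap ε hε1 with hα1 | hα1
        · rw [hα1, one_mul] at v1 v2 v3
          interval_cases i <;> interval_cases j <;>
            first | rfl | (simp only [v0, v1, v2, v3, v4] at hij; linarith)
        · interval_cases i <;> interval_cases j <;>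
            first | rfl | (simp only [v0, v1, v2, v3, v4] at hij; linarith))
      (fun i hi => by
        have hi : i < 4 := by omega
        interval_cases i <;> simp [z, v0, v1, v2, v3, v4] <;> linarith)
      (condValue_le_of_forall_eq_or_eq (fun i => by
        rw [paddedValue]
        split_ifs with hi
        · exact hε.le.trans (hvε i hi)
        · positivity) (by norm_num) fun i hi => by
        by_contra hne
        simp [paddedSize, z, hne] at hi)
      (fun n I hI hn hIv => by
        have h0 := hIv ⟨0, by omega⟩ (by norm_num)
        have h4 := hIv ⟨4, by omega⟩ (by norm_num)
        have h5 := I.value_add_value_le_opt (x := ⟨0, by omega⟩) (y := ⟨4, by omega⟩)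
          (by simp) h0.2 h4.2
        rw [h0.1, h4.1] at h5
        simp only [v0, v4] at h5
        linarith)
    refine this.trans (le_of_eq ?_)
    rw [← ha]
    simp only [Finset.sum_range_succ, Finset.sum_range_zero, v0, v1, v2, v3, v4,
      show paddedValue 5 v ε 0 = v 0 from rfl, show paddedValue 5 v ε 4 = v 4 from
        if_pos (by norm_num)]
    ring
  have htight := firstProb_zero_eq_threshold
  have h0 := firstProb_inv_exp_zero
  rw [← ha] at htight h0
  have h1 := firstProb_succ (1 / Real.exp 1) 0
  rw [← ha, h0] at h1
  have hn := firstProb_nonneg inv_exp_pos inv_exp_lt_one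
  rw [← ha] at hn
  have hpos : 0 < a 1 + a 2 + a 3 := by
    have h1' : a 1 = 1 / Real.exp 1 * (1 / Real.exp 1) := by
      rw [show a 1 = a (0 + 1) from rfl, h1]; norm_num; ring
    have := mul_pos inv_exp_pos inv_exp_pos
    linarith [hn 2, hn 3]
  refine le_of_mul_le_mul_right ?_ hpos
  linarith

theorem mainTheorem1 :
    |boostThreshold - 1.400382| < 0.0000005 ∧
    ∀ α c : ℝ, 1 ≤ α → 0 < c → c < 1 →
      (IsAsymptoticallyCompetitive α c (1 / Real.exp 1) ↔
        boostThreshold ≤ α ∧ α ≤ Real.exp 1 / (Real.exp 1 - 1) ∧ c = 1 / Real.exp 1) := by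
  refine ⟨abs_boostThreshold_sub_lt, fun α c hα hc hc1 => ⟨fun h => ?_, ?_⟩⟩
  · obtain rfl := h.sample_eq hα hc hc1
    exact ⟨h.boostThreshold_le hα, h.boost_le hα, rfl⟩
  · rintro ⟨hθ, hα', rfl⟩
    exact isAsymptoticallyCompetitive hα hθ hα'
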